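/- Let $\mathbb F$ be one of $\mathbb R,\mathbb C,\mathbb H$, $d=\dim_{\mathbb R}\mathbb F\in\{1,2,4\}$, $q\ge 2$ an integer, $G=GL(q,\mathbb F)$ and $K=U(q,\mathbb F)$ with normalized Haar measure $du$. For $g\in G$ let $\ln\sigma_{sing}(g)\in\mathbb R^q$ be the vector of the logarithms of the singular values of $g$ (the square roots of the eigenvalues of $g^*g$), in decreasing order. For a positive definite Hermitian $q\times q$ matrix $x$ over $\mathbb F$ let $\Delta_r(x)$ be its $r$-th leading principal minor (for $\mathbb F=\mathbb H$ with the Dieudonné determinant $\det=(\det_{\mathbb C})^{1/2}$), and for $\lambda\in\mathbb C^q$ put $\Delta_\lambda(x)=\Delta_1(x)^{\lambda_1-\lambda_2}\cdots\Delta_{q-1}(x)^{\lambda_{q-1}-\lambda_q}\Delta_q(x)^{\lambda_q}$. Let $\rho_l=\frac d2(q+1-2l)$ for $l=1,\dots,q$, and let $$\varphi_\lambda(t)=\int_K\Delta_{(i\lambda-\rho)/2}\bigl(u^{-1}\,\mathrm{diag}(e^{2t_1},\dots,e^{2t_q})\,u\bigr)\,du\qquad(t\in\mathbb R^q,\ \lambda\in\mathbb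 C^q)$$ be the spherical functions. Define the moment functions $$m_{\mathbf 1}(t)=\Bigl(\tfrac{\partial}{\partial\lambda_j}\varphi_{-i\rho-i\lambda}(t)\big|_{\lambda=0}\Bigr)_{j=1,\dots,q},\qquad m_{\mathbf 2}(t)=\Bigl(\tfrac{\partial^2}{\partial\lambda_j\partial\lambda_l}\varphi_{-i\rho-i\lambda}(t)\big|_{\lambda=0}\Bigr)_{j,l=1,\dots,q}.$$ Let $X_1,X_2,\dots$ be i.i.d. $G$-valued random variables whose common law $\nu_G$ is $K$-biinvariant, let $S_k=X_1X_2\cdots X_k$ (with $S_0=I_q$), and let $\nu$ be the image of $\nu_G$ under $\ln\sigma_{sing}$, a probability measure on $\{t\in\mathbb R^q: t_1\ge\cdots\ge t_q\}$. Suppose that $\nu$ admits second moments, i.e. $\int t_j^2\,d\nu(t)<\infty$ for $j=1,\dots,q$. Then $m_{\mathbf 1}$ and all entries of $m_{\mathbf 2}$ are $\nu$-integrable; with the row vector $$m_{\mathbf 1}(\nu)=\int m_{\mathbf 1}\,d\nu\qquad\text{and the matrix}\qquad \Sigma^2(\nu)=\int m_{\mathbf 2}\,d\nu-m_{\mathbf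 1}(\nu)^t\,m_{\mathbf 1}(\nu),$$ the matrix $\Sigma^2(\nu)$ is positive semidefinite, and for $k\to\infty$ $$\frac1{\sqrt k}\bigl(\ln\sigma_{sing}(S_k)-k\cdot m_{\mathbf 1}(\nu)\bigr)\longrightarrow N(0,\Sigma^2(\nu))\qquad\text{in distribution}.$$ -/

import Mathlib

open MeasureTheory ProbabilityTheory Matrix Filter
open scoped ENNReal Topology

noncomputable section

namespace BiinvariantWalk

variable (F : Type*) [NormedDivisionRing F] [NormedAlgebra ℝ F] [StarRing F] [CStarRing F]

/-- `F` is one of the (skew-)fields `ℝ`, `ℂ`, `ℍ`, as a real algebra with conjugation. -/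
def IsRealComplexOrQuaternion : Prop :=
  Nonempty (F ≃⋆ₐ[ℝ] ℝ) ∨ Nonempty (F ≃⋆ₐ[ℝ] ℂ) ∨ Nonempty (F ≃⋆ₐ[ℝ] Quaternion ℝ)

/-- The unitary group `U(q, F)` of all `u` with `u* u = u u* = 1`. -/
abbrev U (q : ℕ) := unitary (Matrix (Fin q) (Fin q) F)

variable {F}

/-- `GL(q, F)` and `U(q, F)` carry their Borel σ-algebras. -/
instance instMeasurableSpaceGL (q : ℕ) : MeasurableSpace (GL (Fin q) F) := borel _

instance instBorelSpaceGL (q : ℕ) : BorelSpace (GL (Fin q) F) := ⟨rfl⟩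

instance instMeasurableSpaceU (q : ℕ) : MeasurableSpace (U F q) := borel _

instance instBorelSpaceU (q : ℕ) : BorelSpace (U F q) := ⟨rfl⟩

instance instLocallyCompactSpaceU [FiniteDimensional ℝ F] (q : ℕ) :
    LocallyCompactSpace (U F q) := by
  have : ProperSpace F := FiniteDimensional.proper_real F
  have : LocallyCompactSpace (Matrix (Fin q) (Fin q) F) :=
    inferInstanceAs (LocallyCompactSpace (Fin q → Fin q → F))
  exact (isClosed_unitary
    (R := Matrix (Fin q) (Fin q) F)).isClosedEmbedding_subtypeVal.locallyCompactSpace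

variable (F) in
/-- The normalized Haar measure `du` on the compact group `U(q, F)`. -/
def haarU [FiniteDimensional ℝ F] (q : ℕ) : Measure (U F q) :=
  ((Measure.haar : Measure (U F q)) Set.univ)⁻¹ • Measure.haar

/-- The matrix `A` acting on the column space `F^n`, viewed as a real vector space of
dimension `n * dim_ℝ F`. -/
def realLin {n : Type*} [Fintype n] (A : Matrix n n F) : (n → F) →ₗ[ℝ] (n → F) where
  toFun v := A *ᵥ v
  map_add' v w := Matrix.mulVec_add A v w
  map_smul' c v := Matrix.mulVec_smul A c v

/-- The eigenvalues of a Hermitian matrix `A` over `F`, in decreasing order and counted with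
multiplicity over `F`. As an eigenvalue of the real operator `realLin A`, an eigenvalue of `A`
has `d = dim_ℝ F` times its multiplicity over `F`, so every `d`-th one is taken. -/
def eigenvalues [FiniteDimensional ℝ F] {q : ℕ} (A : Matrix (Fin q) (Fin q) F) (j : Fin q) : ℝ :=
  ((realLin A).charpoly.roots.sort (· ≥ ·)).getD (Module.finrank ℝ F * j) 0

/-- The singular spectrum of `g`: the square roots of the eigenvalues of `g* g`, in decreasing
order. -/
def singularSpectrum [FiniteDimensional ℝ F] {q : ℕ} (g : GL (Fin q) F) (j : Fin q) : ℝ :=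
  √(eigenvalues ((g : Matrix (Fin q) (Fin q) F)ᴴ * (g : Matrix (Fin q) (Fin q) F)) j)

/-- The map `ln σ_sing` from `GL(q, F)` to (the Weyl chamber in) `ℝ^q`. -/
def logSing [FiniteDimensional ℝ F] {q : ℕ} (g : GL (Fin q) F) : EuclideanSpace ℝ (Fin q) :=
  WithLp.toLp 2 fun j => Real.log (singularSpectrum g j)

/-- Determinant of a positive definite Hermitian matrix over `F` (the product of its eigenvalues).
The real determinant is its `d`-th power, `d = dim_ℝ F`; so this is the usual determinant for
`ℝ` and `ℂ`, and the Dieudonné determinant `(det_ℂ A)^(1/2)` for `ℍ`. -/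
def hermDet {n : Type*} [Fintype n] (A : Matrix n n F) : ℝ :=
  (LinearMap.det (realLin A)) ^ (1 / (Module.finrank ℝ F : ℝ))

/-- The principal minor of `A` on the rows and columns with (0-based) index at most `r`, which is
`Δ_{r+1}(A)` in 1-based numbering. -/
def minor {q : ℕ} (A : Matrix (Fin q) (Fin q) F) (r : Fin q) : ℝ :=
  hermDet (A.submatrix (Subtype.val : {i // i ≤ r} → Fin q) Subtype.val)

/-- The power function
`Δ_λ(x) = Δ_1(x)^(λ_1 - λ_2) ⋯ Δ_{q-1}(x)^(λ_{q-1} - λ_q) Δ_q(x)^λ_q`. -/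
def powerFun {q : ℕ} (lam : Fin q → ℂ) (x : Matrix (Fin q) (Fin q) F) : ℂ :=
  ∏ r : Fin q,
    (minor x r : ℂ) ^ (lam r - if h : (r : ℕ) + 1 < q then lam ⟨(r : ℕ) + 1, h⟩ else 0)

variable (F)

/-- The half sum of positive roots, `ρ_l = (d/2) (q + 1 - 2 l)` for `l = 1, …, q`. -/
def rho (q : ℕ) (l : Fin q) : ℝ :=
  (Module.finrank ℝ F : ℝ) / 2 * ((q : ℝ) + 1 - 2 * ((l : ℝ) + 1))

/-- The diagonal matrix `e^{2t}`. -/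
def expDiag {q : ℕ} (t : EuclideanSpace ℝ (Fin q)) : Matrix (Fin q) (Fin q) F :=
  Matrix.diagonal fun i => algebraMap ℝ F (Real.exp (2 * t i))

variable [FiniteDimensional ℝ F]

/-- The spherical function `φ_λ` of `(GL(q, F), U(q, F))`, through the Harish-Chandra integral
`φ_λ(t) = ∫ Δ_{(iλ - ρ)/2}(u⁻¹ e^{2t} u) du`. -/
def spherical {q : ℕ} (lam : Fin q → ℂ) (t : EuclideanSpace ℝ (Fin q)) : ℂ :=
  ∫ u : U F q, powerFun (fun l => (Complex.I * lam l - (rho F q l : ℂ)) / 2)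
    (((u⁻¹ : U F q) : Matrix (Fin q) (Fin q) F) * expDiag F t *
      (u : Matrix (Fin q) (Fin q) F)) ∂(haarU F q)

/-- The moment function `∂_{j_1} ⋯ ∂_{j_n} φ_{-iρ-iλ}(t)` at `λ = 0`, with partial derivatives in
the real spectral variables `λ_1, …, λ_q`. It is `m_l(t)` for the multiindex `l` that counts how
often each index occurs in the list. -/
def momentFun {q : ℕ} (js : List (Fin q)) (t : EuclideanSpace ℝ (Fin q)) : ℝ :=
  (js.foldr (fun j f lam => lineDeriv ℝ f lam (Pi.single j 1))
    (fun lam : Fin q → ℝ =>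
      spherical F (fun l => -Complex.I * (rho F q l : ℂ) - Complex.I * (lam l : ℂ)) t) 0).re

/-- The vector `m_1(t)` of moment functions of first order. -/
def m1 {q : ℕ} (t : EuclideanSpace ℝ (Fin q)) : EuclideanSpace ℝ (Fin q) :=
  WithLp.toLp 2 fun j => momentFun F [j] t

/-- The matrix `m_2(t)` of moment functions of second order. -/
def m2 {q : ℕ} (t : EuclideanSpace ℝ (Fin q)) : Matrix (Fin q) (Fin q) ℝ :=
  Matrix.of fun j l => momentFun F [j, l] t

/-- The dispersion `m_1(ν) = ∫ m_1 dν`. -/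
def dispersion {q : ℕ} (ν : Measure (EuclideanSpace ℝ (Fin q))) : EuclideanSpace ℝ (Fin q) :=
  ∫ t, m1 F t ∂ν

/-- The modified covariance matrix `Σ²(ν) = ∫ m_2 dν - m_1(ν)ᵗ m_1(ν)`. -/
def modCov {q : ℕ} (ν : Measure (EuclideanSpace ℝ (Fin q))) : Matrix (Fin q) (Fin q) ℝ :=
  Matrix.of fun j l => (∫ t, m2 F t j l ∂ν) - dispersion F ν j * dispersion F ν l

end BiinvariantWalk

namespace BiinvariantWalk

variable {F : Type*} [NormedDivisionRing F] [StarRing F]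

/-- `ν` is invariant under left and right multiplication with elements of `U(q, F)`. -/
def IsBiinvariant {q : ℕ} (ν : Measure (GL (Fin q) F)) : Prop :=
  ∀ u : U F q, ν.map (fun g => Unitary.toUnits u * g) = ν ∧
    ν.map (fun g => g * Unitary.toUnits u) = ν

/-- The random walk `S_k = X_1 ⋯ X_k` with `S_0 = 1`, for increments numbered from `0`
(`X 0` is `X_1`, and so on). -/
def walk {Ω : Type*} {q : ℕ} (X : ℕ → Ω → GL (Fin q) F) : ℕ → Ω → GL (Fin q) F
  | 0, _ => 1
  | k + 1, ω => walk X k ω * X k ω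

end BiinvariantWalk

end

open BiinvariantWalk

/-!
The Iwasawa projection `H(g)` is the logarithm of the diagonal of the triangular factor of `g`; its
partial sums are half the logarithms of the leading minors of `g* g`. For every `x` there is a
unitary `κ` with `H(g x) = H(g κ) + H(x)` for all `g`, so by right invariance `H(S_k)` has the law
of a sum of `k` independent copies of `H(X_1)`. The moment functions `m_1` and `m_2` at
`ln σ_sing(g)` are the Haar averages over `u` of `H(g u)` and of the products of its coordinates,
whence `m_1(ν)` and `Σ²(ν)` are the mean and the covariance matrix of `H(X_1)`, and the classical
central limit theorem applies to `H(S_k)`.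

The partial sums of `ln σ_sing(g)` exceed those of `H(g)` by a defect which, for `g = k e^t u`, is
bounded by a function of `u` alone. This function is finite for almost every `u` because the leading
minors of `u` do not vanish, so by right invariance the defects of the `S_k` are tight, and they
disappear after division by `√k`.
-/

noncomputable section

namespace BiinvariantWalk

/-- A real division algebra whose conjugation satisfies `x* x = |x|²`, which covers `ℝ`, `ℂ` and
`ℍ` uniformly. -/
class NormSqStar (F : Type*) [NormedDivisionRing F] [NormedAlgebra ℝ F] [StarRing F] : Prop where
  star_mul_self (x : F) : star x * x = algebraMap ℝ F (‖x‖ ^ 2)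

theorem IsRealComplexOrQuaternion.normSqStar {F : Type*} [NormedDivisionRing F] [NormedAlgebra ℝ F]
    [StarRing F] [CStarRing F] (hF : IsRealComplexOrQuaternion F) : NormSqStar F where
  star_mul_self x := by
    obtain ⟨r, hr, h⟩ : ∃ r : ℝ, 0 ≤ r ∧ star x * x = algebraMap ℝ F r := by
      rcases hF with ⟨⟨e⟩⟩ | ⟨⟨e⟩⟩ | ⟨⟨e⟩⟩
      · refine ⟨e x ^ 2, sq_nonneg _, EquivLike.injective e ?_⟩
        rw [map_mul, map_star, AlgHomClass.commutes e]
        simp [sq]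
      · refine ⟨Complex.normSq (e x), Complex.normSq_nonneg _, EquivLike.injective e ?_⟩
        rw [map_mul, map_star, AlgHomClass.commutes e]
        exact (Complex.normSq_eq_conj_mul_self (z := e x)).symm
      · refine ⟨Quaternion.normSq (e x), Quaternion.normSq_nonneg, EquivLike.injective e ?_⟩
        rw [map_mul, map_star, AlgHomClass.commutes e]
        exact Quaternion.star_mul_self _
    have hnorm := CStarRing.norm_star_mul_self (x := x)
    rw [h, norm_algebraMap', Real.norm_of_nonneg hr] at hnorm
    rw [h, hnorm, sq]

section Scalars

variable {F : Type*} [NormedDivisionRing F] [NormedAlgebra ℝ F] [StarRing F] [NormSqStar F]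

theorem star_mul_self_eq (x : F) : star x * x = algebraMap ℝ F (‖x‖ ^ 2) :=
  NormSqStar.star_mul_self x

instance : CStarRing F :=
  ⟨fun x => by rw [star_mul_self_eq, norm_algebraMap', Real.norm_of_nonneg (sq_nonneg _), sq]⟩

theorem mul_star_self_eq (x : F) : x * star x = algebraMap ℝ F (‖x‖ ^ 2) := by
  simpa using star_mul_self_eq (star x)

theorem star_algebraMap_real (r : ℝ) : star (algebraMap ℝ F r) = algebraMap ℝ F r := by
  rcases eq_or_ne r 0 with rfl | hr
  · simp
  · refine mul_right_cancel₀ (b := algebraMap ℝ F r) (by simpa using hr) ?_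
    rw [star_mul_self_eq, norm_algebraMap', Real.norm_eq_abs, sq_abs, sq, map_mul]

instance : StarModule ℝ F :=
  ⟨fun r x => by
    rw [star_trivial r, Algebra.smul_def, star_mul, star_algebraMap_real, ← Algebra.commutes,
      Algebra.smul_def]⟩

theorem add_star_self_eq (x : F) :
    x + star x = algebraMap ℝ F (2 * ((‖1 + x‖ ^ 2 - ‖1 - x‖ ^ 2) / 4)) := by
  refine smul_right_injective F (two_ne_zero' ℝ) ?_
  calc (2 : ℝ) • (x + star x) = star (1 + x) * (1 + x) - star (1 - x) * (1 - x) := by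
        simp only [star_add, star_sub, star_one, two_smul]; noncomm_ring
    _ = (2 : ℝ) • algebraMap ℝ F (2 * ((‖1 + x‖ ^ 2 - ‖1 - x‖ ^ 2) / 4)) := by
        rw [star_mul_self_eq, star_mul_self_eq, ← map_sub, Algebra.smul_def, ← map_mul]
        congr 1
        ring

/-- The real part `(x + x*) / 2`, written by polarization so that its values are real numbers. -/
def rePart : F →ₗ[ℝ] ℝ where
  toFun x := (‖1 + x‖ ^ 2 - ‖1 - x‖ ^ 2) / 4
  map_add' x y := by
    have h : (x + y) + star (x + y) = (x + star x) + (y + star y) := by rw [star_add]; abel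
    simp only [add_star_self_eq, ← map_add, (algebraMap ℝ F).injective.eq_iff] at h
    linarith
  map_smul' c x := by
    have h : c • x + star (c • x) = c • (x + star x) := by
      rw [star_smul, star_trivial, smul_add]
    simp only [add_star_self_eq, Algebra.smul_def c (algebraMap ℝ F _), ← map_mul,
      (algebraMap ℝ F).injective.eq_iff] at h
    simp only [RingHom.id_apply, smul_eq_mul]
    linarith

theorem continuous_rePart : Continuous (rePart : F → ℝ) :=
  show Continuous fun x : F => (‖1 + x‖ ^ 2 - ‖1 - x‖ ^ 2) / 4 by fun_prop

theorem add_star_eq_rePart (x : F) : x + star x = algebraMap ℝ F (2 * rePart x) :=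
  add_star_self_eq x

theorem rePart_star (x : F) : rePart (star x) = rePart x := by
  have h := add_star_eq_rePart (star x)
  rw [star_star, add_comm, add_star_eq_rePart, (algebraMap ℝ F).injective.eq_iff] at h
  linarith

theorem algebraMap_rePart {x : F} (hx : star x = x) : algebraMap ℝ F (rePart x) = x := by
  refine smul_right_injective F (two_ne_zero' ℝ) ?_
  simp only [Algebra.smul_def (2 : ℝ) (algebraMap ℝ F _), ← map_mul, ← add_star_eq_rePart, hx,
    two_smul]

@[simp]
theorem rePart_algebraMap (r : ℝ) : rePart (algebraMap ℝ F r) = r :=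
  (algebraMap ℝ F).injective (algebraMap_rePart (star_algebraMap_real r))

theorem rePart_mul_comm (x y : F) : rePart (x * y) = rePart (y * x) := by
  have h : (x + star y) * star (x + star y) = star (x + star y) * (x + star y) := by
    rw [mul_star_self_eq, star_mul_self_eq]
  have hre := congrArg rePart h
  simp only [star_add, star_star, add_mul, mul_add, mul_star_self_eq, star_mul_self_eq, map_add,
    rePart_algebraMap] at hre
  rw [← star_mul y x, ← star_mul x y, rePart_star, rePart_star] at hre
  linarith

end Scalars

/-! ### QR decomposition -/

section Reflections

variable {F : Type*} [NormedDivisionRing F] {n : Type*} [Fintype n]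

/-- The squared Euclidean norm of a column vector over `F`. -/
def sqNorm (w : n → F) : ℝ := ∑ i, ‖w i‖ ^ 2

theorem sqNorm_nonneg (w : n → F) : 0 ≤ sqNorm w :=
  Finset.sum_nonneg fun _ _ => sq_nonneg _

theorem sqNorm_eq_zero {w : n → F} : sqNorm w = 0 ↔ w = 0 := by
  simp [sqNorm, Finset.sum_eq_zero_iff_of_nonneg, funext_iff]

variable [NormedAlgebra ℝ F] [StarRing F] [NormSqStar F]

theorem star_dotProduct_self (w : n → F) : star w ⬝ᵥ w = algebraMap ℝ F (sqNorm w) := by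
  simp [sqNorm, dotProduct, map_sum, star_mul_self_eq]

variable [DecidableEq n]

/-- The reflection `1 - 2 w w* / |w|²`, which is the identity for `w = 0` because `2 / 0 = 0`. -/
def reflection (w : n → F) : Matrix n n F := 1 - (2 / sqNorm w) • vecMulVec w (star w)

omit [NormSqStar F] in
theorem reflection_mulVec (w x : n → F) : reflection w *ᵥ x =
    x - (2 / sqNorm w) • MulOpposite.op (star w ⬝ᵥ x) • w := by
  rw [reflection, sub_mulVec, one_mulVec, smul_mulVec, vecMulVec_mulVec]

omit [NormSqStar F] in
theorem reflection_mulVec_of_dotProduct_eq_zero {w x : n → F} (h : star w ⬝ᵥ x = 0) :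
    reflection w *ᵥ x = x := by
  simp [reflection_mulVec, h]

theorem conjTranspose_reflection (w : n → F) : (reflection w)ᴴ = reflection w := by
  simp [reflection, conjTranspose_vecMulVec]

theorem reflection_mul_self (w : n → F) : reflection w * reflection w = 1 := by
  have hsq : vecMulVec w (star w) * vecMulVec w (star w) = sqNorm w • vecMulVec w (star w) := by
    rw [vecMulVec_mul_vecMulVec, star_dotProduct_self]
    ext i j
    simp [vecMulVec_apply, Algebra.smul_def, Algebra.left_comm]
  have hcoef : 2 / sqNorm w * (2 / sqNorm w * sqNorm w) = 2 / sqNorm w + 2 / sqNorm w := by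
    rcases eq_or_ne (sqNorm w) 0 with h | h
    · simp [h]
    · rw [div_mul_cancel₀ _ h]; ring
  rw [reflection, sub_mul, one_mul, mul_sub, mul_one, smul_mul_smul_comm, hsq, smul_smul,
    mul_assoc, hcoef, add_smul]
  abel

theorem reflection_mem_unitary (w : n → F) : reflection w ∈ unitary (Matrix n n F) := by
  rw [Unitary.mem_iff, star_eq_conjTranspose, conjTranspose_reflection, reflection_mul_self]
  exact ⟨rfl, rfl⟩

theorem reflection_sub_mulVec {x y : n → F} (h : sqNorm x = sqNorm y) {c : ℝ}
    (hc : star x ⬝ᵥ y = algebraMap ℝ F c) : reflection (y - x) *ᵥ y = x := by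
  have hc' : star y ⬝ᵥ x = algebraMap ℝ F c := by
    rw [star_dotProduct, hc, star_algebraMap_real]
  have hy : star (y - x) ⬝ᵥ y = algebraMap ℝ F (sqNorm y - c) := by
    rw [star_sub, sub_dotProduct, star_dotProduct_self, hc, map_sub]
  have hN : sqNorm (y - x) = 2 * (sqNorm y - c) := by
    apply (algebraMap ℝ F).injective
    rw [← star_dotProduct_self, dotProduct_sub, hy, star_sub, sub_dotProduct, hc',
      star_dotProduct_self, h, ← map_sub, ← map_sub]
    congr 1
    ring
  rcases eq_or_ne (sqNorm y - c) 0 with h0 | h0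
  · rw [h0, mul_zero, sqNorm_eq_zero, sub_eq_zero] at hN
    simp [hN, reflection_mulVec]
  · have hop : (2 / sqNorm (y - x)) • MulOpposite.op (algebraMap ℝ F (sqNorm y - c)) • (y - x) =
        y - x := by
      ext i
      rw [hN]
      simp only [Pi.smul_apply, op_smul_eq_mul, ← Algebra.commutes, ← Algebra.smul_def, smul_smul]
      rw [show 2 / (2 * (sqNorm y - c)) * (sqNorm y - c) = 1 by field_simp, one_smul]
    rw [reflection_mulVec, hy, hop, sub_sub_cancel]

end Reflections

section QR

variable {F : Type*} [NormedDivisionRing F] [NormedAlgebra ℝ F] [StarRing F] [NormSqStar F]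

theorem exists_norm_eq_star_mul_eq_algebraMap (a : F) {N : ℝ} (hN : 0 ≤ N) :
    ∃ α : F, ‖α‖ = N ∧ ∃ c : ℝ, star α * a = algebraMap ℝ F c := by
  rcases eq_or_ne a 0 with rfl | ha
  · exact ⟨algebraMap ℝ F N, by simp [abs_of_nonneg hN], 0, by simp⟩
  · refine ⟨(N / ‖a‖) • a, ?_, N / ‖a‖ * ‖a‖ ^ 2, ?_⟩
    · rw [norm_smul, Real.norm_of_nonneg (by positivity), div_mul_cancel₀ _ (norm_ne_zero_iff.2 ha)]
    · rw [star_smul, star_trivial, smul_mul_assoc, star_mul_self_eq, Algebra.smul_def, ← map_mul]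

variable {q : ℕ}

theorem exists_unitary_mulVec_eq_zero_below (k : Fin q) (y : Fin q → F) :
    ∃ v ∈ unitary (Matrix (Fin q) (Fin q) F),
      (∀ x : Fin q → F, (∀ i, k ≤ i → x i = 0) → v *ᵥ x = x) ∧ ∀ i, k < i → (v *ᵥ y) i = 0 := by
  obtain ⟨head, tail, hy, hhead, htail, hk⟩ : ∃ head tail : Fin q → F, y = head + tail ∧
      (∀ i, k ≤ i → head i = 0) ∧ (∀ i, i < k → tail i = 0) ∧ tail k = y k :=
    ⟨fun i => if i < k then y i else 0, fun i => if i < k then 0 else y i,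
      funext fun i => by by_cases h : i < k <;> simp [h], fun i hi => by simp [not_lt.2 hi],
      fun i hi => by simp [hi], by simp⟩
  obtain ⟨α, hα, c, hc⟩ := exists_norm_eq_star_mul_eq_algebraMap (y k) (sqNorm tail).sqrt_nonneg
  have hnorm : sqNorm (Pi.single k α : Fin q → F) = sqNorm tail := by
    rw [sqNorm, Finset.sum_eq_single_of_mem k (Finset.mem_univ k) fun i _ hi => by simp [hi],
      Pi.single_eq_same, hα, Real.sq_sqrt (sqNorm_nonneg _)]
  have hreal : star (Pi.single k α : Fin q → F) ⬝ᵥ tail = algebraMap ℝ F c := by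
    rw [Pi.star_single, single_dotProduct, hk, hc]
  have hfix : ∀ x : Fin q → F, (∀ i, k ≤ i → x i = 0) →
      reflection (tail - Pi.single k α : Fin q → F) *ᵥ x = x := by
    intro x hx
    refine reflection_mulVec_of_dotProduct_eq_zero (Finset.sum_eq_zero fun i _ => ?_)
    rcases lt_or_ge i k with h | h
    · simp [htail i h, h.ne]
    · simp [hx i h]
  refine ⟨_, reflection_mem_unitary _, hfix, fun i hi => ?_⟩
  rw [hy, mulVec_add, reflection_sub_mulVec hnorm hreal, hfix head hhead]
  simp [hhead i hi.le, hi.ne']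

theorem exists_unitary_mul_upperTriangular (x : Matrix (Fin q) (Fin q) F) :
    ∃ u ∈ unitary (Matrix (Fin q) (Fin q) F), (u * x).BlockTriangular id := by
  suffices h : ∀ r ≤ q, ∃ u ∈ unitary (Matrix (Fin q) (Fin q) F),
      ∀ i j : Fin q, (j : ℕ) < r → j < i → (u * x) i j = 0 by
    obtain ⟨u, hu, h⟩ := h q le_rfl
    exact ⟨u, hu, fun i j => h i j j.2⟩
  intro r
  induction r with
  | zero => exact fun _ => ⟨1, one_mem _, fun i j h => absurd h (Nat.not_lt_zero _)⟩
  | succ r ih =>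
    intro hr
    obtain ⟨u, hu, h⟩ := ih (by omega)
    obtain ⟨v, hv, hfix, hclear⟩ :=
      exists_unitary_mulVec_eq_zero_below ⟨r, hr⟩ fun i => (u * x) i ⟨r, hr⟩
    refine ⟨v * u, mul_mem hv hu, fun i j hj hij => ?_⟩
    rw [mul_assoc]
    change (v *ᵥ fun l => (u * x) l j) i = 0
    rcases Nat.lt_succ_iff_lt_or_eq.1 hj with hjr | rfl
    · rw [hfix _ fun l hl => h l j hjr (lt_of_lt_of_le (Fin.lt_def.2 hjr) hl)]
      exact h i j hjr hij
    · exact hclear i hij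

end QR

/-! ### Spectral theorem -/

section RealDiag

variable (F : Type*) [NormedDivisionRing F] [NormedAlgebra ℝ F] {n : Type*} [Fintype n]
  [DecidableEq n]

/-- The real diagonal matrices, as a subalgebra of the matrices over `F`. -/
def realDiag : (n → ℝ) →ₐ[ℝ] Matrix n n F :=
  (diagonalAlgHom ℝ).comp ((Algebra.ofId ℝ F).compLeft n)

theorem realDiag_eq (d : n → ℝ) : realDiag F d = diagonal fun i => algebraMap ℝ F (d i) := rfl

theorem realDiag_const (c : ℝ) : realDiag F (fun _ : n => c) = c • 1 := by
  rw [← map_one (realDiag F), ← map_smul]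
  exact congrArg _ (funext fun _ => (mul_one c).symm)

end RealDiag

section Spectral

variable {F : Type*} [NormedDivisionRing F] [NormedAlgebra ℝ F] [StarRing F] [NormSqStar F]
  {n : Type*} [Fintype n] [DecidableEq n]

theorem sqNorm_col_of_mem_unitary {u : Matrix n n F} (hu : u ∈ unitary (Matrix n n F)) (j : n) :
    sqNorm (fun i => u i j) = 1 := by
  apply (algebraMap ℝ F).injective
  rw [← star_dotProduct_self, map_one, ← one_apply_eq j, ← (Unitary.mem_iff.1 hu).1]
  rfl

theorem isCompact_unitary_matrix [FiniteDimensional ℝ F] :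
    IsCompact (unitary (Matrix n n F) : Set (Matrix n n F)) := by
  have : ProperSpace F := FiniteDimensional.proper_real F
  have hball : IsCompact (Set.univ.pi fun _ : n => Set.univ.pi fun _ : n =>
      Metric.closedBall (0 : F) 1) :=
    isCompact_univ_pi fun _ => isCompact_univ_pi fun _ => isCompact_closedBall 0 1
  refine IsCompact.of_isClosed_subset (X := Matrix n n F) hball isClosed_unitary
    fun u hu i _ j _ => ?_
  have hentry : ‖u i j‖ ^ 2 ≤ 1 :=
    (Finset.single_le_sum (f := fun k => ‖u k j‖ ^ 2) (fun _ _ => sq_nonneg _)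
      (Finset.mem_univ i)).trans_eq (sqNorm_col_of_mem_unitary hu j)
  simpa using hentry

theorem rePart_reflection_conj_apply_self {B : Matrix n n F} (hB : Bᴴ = B) (w : n → F) (k : n) :
    rePart ((reflection w * B * reflection w) k k) = rePart (B k k)
      - 4 / sqNorm w * rePart (w k * (star w ᵥ* B) k)
      + 4 / sqNorm w ^ 2 * (‖w k‖ ^ 2 * rePart (star w ᵥ* B ⬝ᵥ w)) := by
  set W := vecMulVec w (star w) with hW
  have hWB : (W * B) k k = w k * (star w ᵥ* B) k := by
    rw [hW, vecMulVec_mul, vecMulVec_apply]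
  have hBW : (B * W) k k = star ((W * B) k k) := by
    rw [← conjTranspose_apply, conjTranspose_mul, hB, hW, conjTranspose_vecMulVec, star_star]
  have hWBW : rePart ((W * B * W) k k) = ‖w k‖ ^ 2 * rePart (star w ᵥ* B ⬝ᵥ w) := by
    rw [hW, vecMulVec_mul, vecMulVec_mul_vecMulVec, vecMulVec_apply, rePart_mul_comm,
      Pi.smul_apply, smul_eq_mul, Pi.star_apply, mul_assoc, star_mul_self_eq, ← Algebra.commutes,
      ← Algebra.smul_def, map_smul, smul_eq_mul]
  have hexpand : reflection w * B * reflection w = B - (2 / sqNorm w) • (W * B + B * W)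
      + (2 / sqNorm w * (2 / sqNorm w)) • (W * B * W) := by
    simp only [reflection, ← hW, sub_mul, mul_sub, one_mul, mul_one, smul_mul_assoc,
      mul_smul_comm, smul_sub, smul_add, smul_smul]
    abel
  simp only [hexpand, Matrix.add_apply, Matrix.sub_apply, Matrix.smul_apply, map_add, map_sub,
    map_smul, smul_eq_mul, hBW, rePart_star, hWBW, hWB]
  ring

/-- Among its unitary conjugates, `B` maximizes the real part of the trace weighted by `wt`. -/
def IsMaxWeightedTrace (wt : n → ℝ) (B : Matrix n n F) : Prop :=
  ∀ v ∈ unitary (Matrix n n F),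
    ∑ k, wt k * rePart ((vᴴ * B * v) k k) ≤ ∑ k, wt k * rePart (B k k)

theorem IsMaxWeightedTrace.sum_mul_sqNorm_le {B : Matrix n n F} {wt : n → ℝ}
    (hmax : IsMaxWeightedTrace wt B) (hB : Bᴴ = B)
    (w : n → F) :
    (∑ k, wt k * ‖w k‖ ^ 2) * ∑ k, rePart (w k * (star w ᵥ* B) k) ≤
      sqNorm w * ∑ k, wt k * rePart (w k * (star w ᵥ* B) k) := by
  have hform : rePart (star w ᵥ* B ⬝ᵥ w) = ∑ k, rePart (w k * (star w ᵥ* B) k) := by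
    rw [dotProduct, map_sum]
    exact Finset.sum_congr rfl fun k _ => rePart_mul_comm _ _
  have h := hmax _ (reflection_mem_unitary w)
  simp only [conjTranspose_reflection, rePart_reflection_conj_apply_self hB, hform, mul_add,
    mul_sub, Finset.sum_add_distrib, Finset.sum_sub_distrib, mul_left_comm (wt _) (4 / _),
    ← mul_assoc (wt _) (‖_‖ ^ 2), ← Finset.mul_sum, ← Finset.sum_mul] at h
  rcases (sqNorm_nonneg w).eq_or_lt with h0 | h0
  · simp [sqNorm_eq_zero.1 h0.symm]
  · have h' : 4 / sqNorm w ^ 2 * ((∑ k, wt k * ‖w k‖ ^ 2) * ∑ k, rePart (w k * (star w ᵥ* B) k))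
        ≤ 4 / sqNorm w ^ 2 * (sqNorm w * ∑ k, wt k * rePart (w k * (star w ᵥ* B) k)) := by
      have e : 4 / sqNorm w ^ 2 * (sqNorm w * ∑ k, wt k * rePart (w k * (star w ᵥ* B) k)) =
          4 / sqNorm w * ∑ k, wt k * rePart (w k * (star w ᵥ* B) k) := by
        field_simp
      rw [e]
      linarith
    exact le_of_mul_le_mul_left h' (by positivity)

theorem IsMaxWeightedTrace.plane_inequality {B : Matrix n n F} {wt : n → ℝ}
    (hmax : IsMaxWeightedTrace wt B) (hB : Bᴴ = B)
    {i j : n} (hij : wt j < wt i) (x : F) {τ : ℝ} (hτ : 0 < τ) :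
    τ * ‖x‖ ^ 2 * (rePart (B j j) - rePart (B i i)) + (‖x‖ ^ 2 - τ ^ 2) * rePart (x * B i j) ≤
      0 := by
  have hne : i ≠ j := fun h => hij.ne (by rw [h])
  set w : n → F := Pi.single i (algebraMap ℝ F τ) - Pi.single j x with hw
  have hwi : w i = algebraMap ℝ F τ := by simp [hw, hne]
  have hwj : w j = -x := by simp [hw, hne.symm]
  have hsupp : ∀ k, k ≠ i ∧ k ≠ j → w k = 0 := fun k h => by simp [hw, h.1, h.2]
  have hvec : ∀ k, (star w ᵥ* B) k = τ • B i k - star x * B j k := fun k => by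
    simp [hw, sub_vecMul, single_vecMul, Pi.star_single, star_algebraMap_real, Algebra.smul_def]
  have hji : rePart (star x * B j i) = rePart (x * B i j) := by
    rw [← rePart_star, star_mul, star_star, rePart_mul_comm, ← conjTranspose_apply, hB]
  have hi : rePart (w i * (star w ᵥ* B) i) =
      τ ^ 2 * rePart (B i i) - τ * rePart (x * B i j) := by
    rw [hwi, hvec, ← Algebra.smul_def, map_smul, map_sub, map_smul, hji]
    simp only [smul_eq_mul]; ring
  have hj : rePart (w j * (star w ᵥ* B) j) =
      ‖x‖ ^ 2 * rePart (B j j) - τ * rePart (x * B i j) := by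
    rw [hwj, hvec, neg_mul, mul_sub, mul_smul_comm, ← mul_assoc, mul_star_self_eq,
      ← Algebra.smul_def, neg_sub, map_sub, map_smul, map_smul, smul_eq_mul, smul_eq_mul]
  have h := hmax.sum_mul_sqNorm_le hB w
  rw [sqNorm, Finset.sum_eq_add i j hne (fun k _ hk => by simp [hsupp k hk]) (by simp) (by simp),
    Finset.sum_eq_add i j hne (fun k _ hk => by simp [hsupp k hk]) (by simp) (by simp),
    Finset.sum_eq_add i j hne (fun k _ hk => by simp [hsupp k hk]) (by simp) (by simp),
    Finset.sum_eq_add i j hne (fun k _ hk => by simp [hsupp k hk]) (by simp) (by simp),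
    hi, hj, hwi, hwj, norm_neg, norm_algebraMap', Real.norm_of_nonneg hτ.le] at h
  refine nonpos_of_mul_nonpos_right (a := τ * (wt i - wt j)) ?_ (mul_pos hτ (sub_pos.2 hij))
  linarith

theorem IsMaxWeightedTrace.apply_eq_zero_and_le {B : Matrix n n F} {wt : n → ℝ}
    (hmax : IsMaxWeightedTrace wt B) (hB : Bᴴ = B)
    {i j : n} (hij : wt j < wt i) : B i j = 0 ∧ rePart (B j j) ≤ rePart (B i i) := by
  set D := rePart (B j j) - rePart (B i i)
  have hplane := hmax.plane_inequality hB hij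
  constructor
  · by_contra h0
    have hpos : 0 < ‖B i j‖ ^ 2 := by positivity
    have hτ : ∀ τ > 0, τ * D + ‖B i j‖ ^ 2 - τ ^ 2 ≤ 0 := fun τ hτ => by
      have h := hplane (star (B i j)) hτ
      rw [star_mul_self_eq, rePart_algebraMap, norm_star] at h
      exact nonpos_of_mul_nonpos_right (by linarith) hpos
    have hlim : Tendsto (fun τ : ℝ => τ * D + ‖B i j‖ ^ 2 - τ ^ 2) (𝓝[>] 0) (𝓝 (‖B i j‖ ^ 2)) := by
      have hcont : Continuous fun τ : ℝ => τ * D + ‖B i j‖ ^ 2 - τ ^ 2 := by fun_prop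
      simpa using (hcont.tendsto 0).mono_left nhdsWithin_le_nhds
    exact hpos.not_ge (le_of_tendsto hlim (eventually_mem_nhdsWithin.mono hτ))
  · have h := hplane 1 one_pos
    rw [norm_one] at h
    linarith

/-- Spectral theorem over `F`: a maximizer over `U(n, F)` of the weighted trace of `u* A u`
diagonalizes `A`, with eigenvalues ordered along the weights. -/
theorem exists_unitary_conj_eq_diagonal [FiniteDimensional ℝ F] {A : Matrix n n F}
    (hA : Aᴴ = A) {wt : n → ℝ} (hwt : Function.Injective wt) :
    ∃ u ∈ unitary (Matrix n n F), ∃ d : n → ℝ,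
      uᴴ * A * u = realDiag F d ∧ ∀ i j, wt j ≤ wt i → d j ≤ d i := by
  have hcont : Continuous fun u : Matrix n n F => ∑ k, wt k * rePart ((uᴴ * A * u) k k) := by
    refine continuous_finsetSum _ fun k _ => continuous_const.mul (continuous_rePart.comp ?_)
    have hconj : Continuous fun u : Matrix n n F => uᴴ * A * u := by fun_prop
    exact hconj.matrix_elem k k
  obtain ⟨u, hu, hmax⟩ := isCompact_unitary_matrix.exists_isMaxOn ⟨1, one_mem _⟩ hcont.continuousOn
  set B := uᴴ * A * u with hB
  have hherm : Bᴴ = B := by simp [hB, hA, mul_assoc]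
  have hmaxB : IsMaxWeightedTrace wt B := fun v hv => by
    have h : vᴴ * B * v = (u * v)ᴴ * A * (u * v) := by simp [hB, mul_assoc]
    rw [h]
    exact hmax (mul_mem hu hv)
  have hoff : ∀ i j, wt j < wt i → B i j = 0 ∧ B j i = 0 := fun i j h => by
    have h0 := (hmaxB.apply_eq_zero_and_le hherm h).1
    exact ⟨h0, by rw [← hherm, conjTranspose_apply, h0, star_zero]⟩
  refine ⟨u, hu, fun i => rePart (B i i), Matrix.ext fun i j => ?_, fun i j h => ?_⟩
  · rw [realDiag_eq]
    rcases eq_or_ne i j with rfl | hij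
    · rw [diagonal_apply_eq]
      exact (algebraMap_rePart (congrFun₂ hherm i i)).symm
    · rw [diagonal_apply_ne _ hij]
      exact (hwt.ne hij).lt_or_gt.elim (fun h => (hoff j i h).2) fun h => (hoff i j h).1
  · rcases h.eq_or_lt with h | h
    · rw [hwt h]
    · exact (hmaxB.apply_eq_zero_and_le hherm h).2

end Spectral

/-! ### Determinants of positive semidefinite matrices -/

section RealDet

variable {F : Type*} [NormedDivisionRing F] [NormedAlgebra ℝ F]
  {n : Type*} [Fintype n]

theorem realLin_mul (A B : Matrix n n F) : realLin (A * B) = realLin A * realLin B :=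
  LinearMap.ext fun v => (mulVec_mulVec v A B).symm

theorem realLin_add (A B : Matrix n n F) : realLin (A + B) = realLin A + realLin B :=
  LinearMap.ext fun v => add_mulVec A B v

theorem realLin_smul (c : ℝ) (A : Matrix n n F) : realLin (c • A) = c • realLin A :=
  LinearMap.ext fun v => smul_mulVec c A v

/-- The determinant of `A` as a real operator. It is the `d`-th power of `hermDet A` and, unlike
`hermDet`, multiplicative on all matrices. -/
abbrev realDet (A : Matrix n n F) : ℝ := LinearMap.det (realLin A)

theorem realDet_mul (A B : Matrix n n F) : realDet (A * B) = realDet A * realDet B := by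
  rw [realDet, realLin_mul, map_mul]

variable [DecidableEq n]

theorem realLin_one : realLin (1 : Matrix n n F) = 1 :=
  LinearMap.ext one_mulVec

theorem realDet_one : realDet (1 : Matrix n n F) = 1 := by
  rw [realDet, realLin_one, map_one]

theorem realDet_coe_ne_zero (g : GL n F) : realDet (g : Matrix n n F) ≠ 0 := by
  refine left_ne_zero_of_mul (b := realDet ((g⁻¹ : GL n F) : Matrix n n F)) ?_
  rw [← realDet_mul, Units.mul_inv, realDet_one]
  exact one_ne_zero

theorem realDet_unitary_conj [StarRing F] {u : Matrix n n F} (hu : u ∈ unitary (Matrix n n F))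
    (A : Matrix n n F) : realDet (uᴴ * A * u) = realDet A := by
  have h : realDet uᴴ * realDet u = 1 := by
    rw [← realDet_mul, ← star_eq_conjTranspose, (Unitary.mem_iff.1 hu).1, realDet_one]
  rw [realDet_mul, realDet_mul, mul_right_comm, h, one_mul]

variable [FiniteDimensional ℝ F]

theorem realDet_realDiag (d : n → ℝ) : realDet (realDiag F d) = ∏ i, d i ^ Module.finrank ℝ F := by
  have h : realLin (realDiag F d) =
      LinearMap.pi fun i => (d i • (LinearMap.id : F →ₗ[ℝ] F)).comp (LinearMap.proj i) :=
    LinearMap.ext fun v => funext fun i => by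
      simp [realDiag_eq, realLin, mulVec_diagonal, Algebra.smul_def]
  rw [realDet, h, LinearMap.det_pi]
  simp

theorem pos_of_realDet_realDiag_ne_zero {d : n → ℝ} (hd : 0 ≤ d)
    (h : realDet (realDiag F d) ≠ 0) (i : n) : 0 < d i := by
  refine (hd i).lt_of_ne fun hi => h ?_
  rw [realDet_realDiag]
  exact Finset.prod_eq_zero (Finset.mem_univ i) (by
    rw [← hi, Pi.zero_apply, zero_pow Module.finrank_pos.ne'])

theorem realDet_one_add_mul_comm (A B : Matrix n n F) :
    realDet (1 + A * B) = realDet (1 + B * A) := by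
  set b := Module.finBasis ℝ (n → F)
  have h (A B : Matrix n n F) : LinearMap.toMatrix b b (realLin (1 + A * B)) =
      1 + LinearMap.toMatrix b b (realLin A) * LinearMap.toMatrix b b (realLin B) := by
    rw [realLin_add, realLin_one, realLin_mul, map_add, LinearMap.toMatrix_one,
      LinearMap.toMatrix_mul]
  rw [realDet, realDet, ← LinearMap.det_toMatrix b, ← LinearMap.det_toMatrix b, h, h,
    det_one_add_mul_comm]

theorem realDet_smul_one_add_mul_comm (c : ℝ) (A B : Matrix n n F) :
    realDet (c • 1 + A * B) = realDet (c • 1 + B * A) := by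
  rcases eq_or_ne c 0 with rfl | hc
  · rw [zero_smul, zero_add, zero_add, realDet_mul, realDet_mul, mul_comm]
  · have h (X Y : Matrix n n F) : c • 1 + X * Y = c • (1 + (c⁻¹ • X) * Y) := by
      rw [smul_add, smul_mul_assoc, smul_smul, mul_inv_cancel₀ hc, one_smul]
    rw [h, h, realDet, realDet, realLin_smul, realLin_smul, LinearMap.det_smul, LinearMap.det_smul,
      smul_mul_assoc, ← mul_smul_comm]
    exact congrArg _ (realDet_one_add_mul_comm _ _)

end RealDet

section Psd

variable {F : Type*} [NormedDivisionRing F] [NormedAlgebra ℝ F] [StarRing F] [NormSqStar F]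
  {n m : Type*} [Fintype n] [DecidableEq n] [Fintype m]

theorem realDet_conjTranspose_ne_zero [FiniteDimensional ℝ F] {A : Matrix m m F}
    (h : realDet A ≠ 0) : realDet Aᴴ ≠ 0 := by
  intro h0
  obtain ⟨x, hx : Aᴴ *ᵥ x = 0, hx0⟩ :=
    (Submodule.ne_bot_iff _).1 (LinearMap.bot_lt_ker_of_det_eq_zero h0).ne'
  have hbij := (Module.End.isUnit_iff _).1
    ((LinearMap.isUnit_iff_isUnit_det (realLin A)).2 h.isUnit)
  obtain ⟨y, hy : A *ᵥ y = x⟩ := hbij.2 x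
  have hxx : star x ⬝ᵥ x = 0 := by
    conv_lhs => rw [← hy, star_mulVec, ← dotProduct_mulVec, hy, hx, dotProduct_zero]
  rw [star_dotProduct_self, map_eq_zero] at hxx
  exact hx0 (sqNorm_eq_zero.1 hxx)

theorem conjTranspose_realDiag (d : n → ℝ) : (realDiag F d)ᴴ = realDiag F d := by
  rw [realDiag_eq, diagonal_conjTranspose]
  exact congrArg diagonal (funext fun i => star_algebraMap_real (d i))

/-- Positive semidefinite Hermitian matrices over `F`. -/
def Psd (P : Matrix m m F) : Prop :=
  Pᴴ = P ∧ ∀ x, 0 ≤ rePart (star x ⬝ᵥ (P *ᵥ x))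

theorem Psd.add {P Q : Matrix m m F} (hP : Psd P) (hQ : Psd Q) : Psd (P + Q) := by
  refine ⟨by rw [conjTranspose_add, hP.1, hQ.1], fun x => ?_⟩
  rw [add_mulVec, dotProduct_add, map_add]
  exact add_nonneg (hP.2 x) (hQ.2 x)

theorem Psd.conj {k : Type*} [Fintype k] {P : Matrix m m F} (hP : Psd P) (B : Matrix m k F) :
    Psd (Bᴴ * P * B) := by
  refine ⟨by simp [hP.1, Matrix.mul_assoc], fun x => ?_⟩
  have h := hP.2 (B *ᵥ x)
  rwa [star_mulVec, ← dotProduct_mulVec, mulVec_mulVec, mulVec_mulVec] at h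

theorem psd_realDiag {d : n → ℝ} (hd : 0 ≤ d) : Psd (realDiag F d) := by
  refine ⟨conjTranspose_realDiag d, fun x => ?_⟩
  have h : star x ⬝ᵥ (realDiag F d *ᵥ x) = algebraMap ℝ F (∑ i, d i * ‖x i‖ ^ 2) := by
    rw [map_sum, dotProduct]
    refine Finset.sum_congr rfl fun i _ => ?_
    rw [realDiag_eq, mulVec_diagonal, Pi.star_apply, Algebra.left_comm, star_mul_self_eq, map_mul]
  rw [h, rePart_algebraMap]
  exact Finset.sum_nonneg fun i _ => mul_nonneg (hd i) (sq_nonneg _)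

omit [DecidableEq n] in
theorem psd_conjTranspose_mul_self (B : Matrix n m F) : Psd (Bᴴ * B) := by
  classical
  simpa using (psd_realDiag (F := F) (zero_le_one' (n → ℝ))).conj B

theorem Psd.nonneg_of_conj_eq_realDiag {P : Matrix m m F} (hP : Psd P) {v : Matrix m n F}
    {d : n → ℝ} (h : vᴴ * P * v = realDiag F d) : 0 ≤ d := fun i => by
  have hi : 0 ≤ rePart ((vᴴ * P * v) i i) := by
    rw [Matrix.mul_assoc]
    exact hP.2 (v.col i)
  rwa [h, realDiag_eq, diagonal_apply_eq, rePart_algebraMap] at hi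

variable [FiniteDimensional ℝ F] {P Q : Matrix n n F}

theorem Psd.exists_unitary_conj_eq_realDiag (hP : Psd P) :
    ∃ u ∈ unitary (Matrix n n F), ∃ d : n → ℝ, 0 ≤ d ∧ uᴴ * P * u = realDiag F d := by
  obtain ⟨u, hu, d, h, -⟩ := exists_unitary_conj_eq_diagonal hP.1
    (wt := fun i => ((Fintype.equivFin n i : ℕ) : ℝ))
    (Nat.cast_injective.comp (Fin.val_injective.comp (Fintype.equivFin n).injective))
  exact ⟨u, hu, d, hP.nonneg_of_conj_eq_realDiag h, h⟩

omit [DecidableEq n] in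
theorem Psd.realDet_nonneg (hP : Psd P) : 0 ≤ realDet P := by
  classical
  obtain ⟨u, hu, d, hd, h⟩ := hP.exists_unitary_conj_eq_realDiag
  rw [← realDet_unitary_conj hu, h, realDet_realDiag]
  exact Finset.prod_nonneg fun i _ => pow_nonneg (hd i) _

theorem Psd.one_le_realDet_one_add (hP : Psd P) : 1 ≤ realDet (1 + P) := by
  obtain ⟨u, hu, d, hd, h⟩ := hP.exists_unitary_conj_eq_realDiag
  have hconj : uᴴ * (1 + P) * u = realDiag F (1 + d) := by
    rw [mul_add, add_mul, h, mul_one, ← star_eq_conjTranspose, (Unitary.mem_iff.1 hu).1, map_add,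
      map_one]
  rw [← realDet_unitary_conj hu, hconj, realDet_realDiag]
  exact Finset.one_le_prod fun i _ => one_le_pow₀ (le_add_of_nonneg_right (hd i))

theorem Psd.exists_conj_eq_one (hP : Psd P) (h0 : realDet P ≠ 0) :
    ∃ C : Matrix n n F, Cᴴ * P * C = 1 := by
  obtain ⟨u, hu, d, hd, h⟩ := hP.exists_unitary_conj_eq_realDiag
  have hpos := pos_of_realDet_realDiag_ne_zero (F := F) hd (by rwa [← h, realDet_unitary_conj hu])
  refine ⟨u * realDiag F fun i => (√(d i))⁻¹, ?_⟩
  have hone : (fun i => (√(d i))⁻¹) * (d * fun i => (√(d i))⁻¹) = 1 := by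
    ext i
    have hsqrt := Real.sqrt_pos.2 (hpos i)
    simp only [Pi.mul_apply, Pi.one_apply]
    field_simp
    rw [Real.sq_sqrt (hd i)]
  rw [conjTranspose_mul, conjTranspose_realDiag, ← map_one (realDiag F), ← hone, map_mul, map_mul,
    ← h]
  simp only [mul_assoc]

omit [DecidableEq n] in
theorem Psd.realDet_le_add (hP : Psd P) (hQ : Psd Q) : realDet P ≤ realDet (P + Q) := by
  classical
  rcases hP.realDet_nonneg.eq_or_lt with h0 | h0
  · exact h0 ▸ (hP.add hQ).realDet_nonneg
  obtain ⟨C, hC⟩ := hP.exists_conj_eq_one h0.ne'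
  have hdet (A : Matrix n n F) : realDet (Cᴴ * A * C) = realDet Cᴴ * realDet C * realDet A := by
    rw [realDet_mul, realDet_mul, mul_right_comm]
  have hP1 : realDet Cᴴ * realDet C * realDet P = 1 := by rw [← hdet, hC, realDet_one]
  have hC0 : 0 < realDet Cᴴ * realDet C := pos_of_mul_pos_left (hP1 ▸ one_pos) h0.le
  refine le_of_mul_le_mul_left ?_ hC0
  calc realDet Cᴴ * realDet C * realDet P = 1 := hP1
    _ ≤ realDet (1 + Cᴴ * Q * C) := (hQ.conj C).one_le_realDet_one_add
    _ = realDet Cᴴ * realDet C * realDet (P + Q) := by rw [← hdet, mul_add, add_mul, hC]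

end Psd

section ColumnBlocks

variable {F : Type*} [NormedDivisionRing F] [StarRing F] {n : Type*} [Fintype n] [DecidableEq n]
  {m : Type*} (p : n → Prop)

theorem conjTranspose_mul_submatrix_of_mem_unitary {u : Matrix n n F}
    (hu : u ∈ unitary (Matrix n n F)) :
    (u.submatrix id (Subtype.val : {i // p i} → n))ᴴ *
      u.submatrix id (Subtype.val : {i // p i} → n) = 1 := by
  rw [← toBlock_one_self p, ← (Unitary.mem_iff.1 hu).1]
  rfl

variable [NormedAlgebra ℝ F] [DecidablePred p]

theorem conj_realDiag_eq_add (V : Matrix n m F) (d : n → ℝ) :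
    Vᴴ * realDiag F d * V =
      (V.submatrix (Subtype.val : {i // p i} → n) id)ᴴ *
        realDiag F (fun i : {i // p i} => d i) * V.submatrix (Subtype.val : {i // p i} → n) id +
      (V.submatrix (Subtype.val : {i // ¬ p i} → n) id)ᴴ *
        realDiag F (fun i : {i // ¬ p i} => d i) *
          V.submatrix (Subtype.val : {i // ¬ p i} → n) id := by
  ext i j
  simp only [realDiag_eq, Matrix.add_apply, mul_apply (M := _ * _), mul_diagonal]
  exact (Fintype.sum_subtype_add_sum_subtype p fun k => Vᴴ i k * algebraMap ℝ F (d k) * V k j).symm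

variable {p} in
theorem conj_realDiag_eq_of_support (V : Matrix n m F) {d : n → ℝ} (hd : ∀ i, ¬ p i → d i = 0) :
    Vᴴ * realDiag F d * V =
      (V.submatrix (Subtype.val : {i // p i} → n) id)ᴴ *
        realDiag F (fun i : {i // p i} => d i) * V.submatrix (Subtype.val : {i // p i} → n) id := by
  have h0 : (fun i : {i // ¬ p i} => d i) = 0 := funext fun i => hd i i.2
  rw [conj_realDiag_eq_add p, h0, map_zero, Matrix.mul_zero, Matrix.zero_mul, add_zero]

end ColumnBlocks

section Compressions

variable {F : Type*} [NormedDivisionRing F] [NormedAlgebra ℝ F] [StarRing F] [NormSqStar F]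
  [FiniteDimensional ℝ F] {n m : Type*} [Fintype n] [DecidableEq n] [Fintype m]

theorem realDet_conj_realDiag_mono (V : Matrix n m F) {d d' : n → ℝ} (hd : 0 ≤ d) (h : d ≤ d') :
    realDet (Vᴴ * realDiag F d * V) ≤ realDet (Vᴴ * realDiag F d' * V) := by
  rw [← add_sub_cancel d d', map_add, Matrix.mul_add, Matrix.add_mul]
  exact ((psd_realDiag hd).conj V).realDet_le_add ((psd_realDiag (sub_nonneg.2 h)).conj V)

variable (p : n → Prop) [DecidablePred p]

/-- Sylvester's identity turns `W* D W` into `√D W W* √D`, and `W W* ≤ 1`. -/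
theorem realDet_smul_one_add_conj_le {W : Matrix n n F} (hW : Psd (1 - W * Wᴴ)) {c : ℝ}
    (hc : 0 ≤ c) {d : n → ℝ} (hd : 0 ≤ d) :
    realDet (c • 1 + Wᴴ * realDiag F d * W) ≤ realDet (c • 1 + realDiag F d) := by
  set G := realDiag F fun i => √(d i) with hG
  have hGs : Gᴴ = G := conjTranspose_realDiag _
  have hGG : G * G = realDiag F d := by
    rw [hG, ← map_mul]
    exact congrArg _ (funext fun i => Real.mul_self_sqrt (hd i))
  have hGWWG : Psd (c • 1 + G * W * (Wᴴ * G)) := by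
    rw [← realDiag_const]
    refine (psd_realDiag fun _ => hc).add ?_
    simpa [hGs] using psd_conjTranspose_mul_self (Wᴴ * G)
  have hsum : c • 1 + G * W * (Wᴴ * G) + Gᴴ * (1 - W * Wᴴ) * G = c • 1 + realDiag F d := by
    rw [hGs, ← hGG]
    noncomm_ring
  calc realDet (c • 1 + Wᴴ * realDiag F d * W)
    _ = realDet (c • 1 + Wᴴ * G * (G * W)) := by simp only [← hGG, mul_assoc]
    _ = realDet (c • 1 + G * W * (Wᴴ * G)) := realDet_smul_one_add_mul_comm _ _ _
    _ ≤ realDet (c • 1 + realDiag F d) := hsum ▸ hGWWG.realDet_le_add (hW.conj G)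

variable {u : Matrix n n F} {d : n → ℝ}

omit [FiniteDimensional ℝ F] in
theorem psd_one_sub_toBlock_mul_conjTranspose (hu : u ∈ unitary (Matrix n n F)) :
    Psd (1 - u.toBlock p p * (u.toBlock p p)ᴴ) := by
  set W' := u.toBlock p fun i => ¬ p i
  have h : u.toBlock p p * (u.toBlock p p)ᴴ + W' * W'ᴴ = 1 := by
    rw [← toBlock_one_self p, ← (Unitary.mem_iff.1 hu).2]
    ext i j
    exact Fintype.sum_subtype_add_sum_subtype p fun k => u i k * star (u j k)
  rw [← h, add_sub_cancel_left]
  simpa using psd_conjTranspose_mul_self W'ᴴ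

theorem prod_mul_le_realDet_toBlock_conj (hd : 0 ≤ d) :
    (∏ i : {i // p i}, d i ^ Module.finrank ℝ F) * realDet ((u.toBlock p p)ᴴ * u.toBlock p p) ≤
      realDet ((uᴴ * realDiag F d * u).toBlock p p) := by
  change _ ≤ realDet ((u.submatrix id Subtype.val)ᴴ * realDiag F d * u.submatrix id Subtype.val)
  rw [conj_realDiag_eq_add p, ← realDet_realDiag (F := F), realDet_mul,
    mul_left_comm, ← mul_assoc, ← realDet_mul, ← realDet_mul]
  exact ((psd_realDiag fun i : {i // p i} => hd i).conj _).realDet_le_add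
    ((psd_realDiag fun i : {i // ¬ p i} => hd i).conj _)

theorem realDet_toBlock_conj_le_prod (hu : u ∈ unitary (Matrix n n F)) {c : ℝ} (hc : 0 ≤ c)
    (h1 : ∀ i, p i → c ≤ d i) (h2 : ∀ i, ¬ p i → d i ≤ c) (hd : 0 ≤ d) :
    realDet ((uᴴ * realDiag F d * u).toBlock p p) ≤ ∏ i : {i // p i}, d i ^ Module.finrank ℝ F := by
  set V := u.submatrix id (Subtype.val : {i // p i} → n)
  set e : n → ℝ := fun i => if p i then d i - c else 0 with he
  have hde : d ≤ fun i => c + e i := fun i => by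
    by_cases hi : p i
    · simp [he, hi]
    · simpa [he, hi] using h2 i hi
  have hconst : Vᴴ * realDiag F (fun _ : n => c) * V = c • 1 := by
    rw [realDiag_const, Matrix.mul_smul, Matrix.smul_mul, Matrix.mul_one,
      conjTranspose_mul_submatrix_of_mem_unitary p hu]
  have hblock : (fun i : {i // p i} => e i) = fun i : {i // p i} => d i - c :=
    funext fun i => if_pos i.2
  calc realDet (Vᴴ * realDiag F d * V)
    _ ≤ realDet (Vᴴ * realDiag F ((fun _ => c) + e) * V) := realDet_conj_realDiag_mono V hd hde
    _ = realDet (c • 1 + (u.toBlock p p)ᴴ * realDiag F (fun i : {i // p i} => d i - c) *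
          u.toBlock p p) := by
        rw [map_add, Matrix.mul_add, Matrix.add_mul, hconst,
          conj_realDiag_eq_of_support (p := p) V fun i hi => if_neg hi, hblock]
        rfl
    _ ≤ realDet (c • 1 + realDiag F fun i : {i // p i} => d i - c) :=
        realDet_smul_one_add_conj_le (psd_one_sub_toBlock_mul_conjTranspose p hu) hc
          fun i => sub_nonneg.2 (h1 i i.2)
    _ = ∏ i : {i // p i}, d i ^ Module.finrank ℝ F := by
        rw [← realDiag_const, ← map_add, realDet_realDiag]
        simp

end Compressions

/-! ### Singular values and leading minors -/

section Eigenvalues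

variable {F : Type*} [NormedDivisionRing F] [NormedAlgebra ℝ F] [StarRing F]
  [FiniteDimensional ℝ F] {q : ℕ} {u : Matrix (Fin q) (Fin q) F}

theorem eval_charpoly_realLin_conj (hu : u ∈ unitary (Matrix (Fin q) (Fin q) F)) (d : Fin q → ℝ)
    (c : ℝ) : (realLin (uᴴ * realDiag F d * u)).charpoly.eval c =
      ∏ i, (c - d i) ^ Module.finrank ℝ F := by
  have hconj : c • 1 - uᴴ * realDiag F d * u = uᴴ * realDiag F (fun i => c - d i) * u := by
    rw [show (fun i => c - d i) = (fun _ => c) - d from rfl, map_sub, Matrix.mul_sub,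
      Matrix.sub_mul, realDiag_const, Matrix.mul_smul, Matrix.smul_mul, Matrix.mul_one]
    congr 2
    exact (Unitary.mem_iff.1 hu).1.symm
  have hlin : algebraMap ℝ _ c - realLin (uᴴ * realDiag F d * u) =
      realLin (uᴴ * realDiag F (fun i => c - d i) * u) := by
    rw [← hconj, eq_comm, eq_sub_iff_add_eq, ← realLin_add, sub_add_cancel, realLin_smul,
      realLin_one]
    rfl
  rw [LinearMap.eval_charpoly, hlin, ← realDet, realDet_unitary_conj hu, realDet_realDiag]

theorem charpoly_realLin_conj (hu : u ∈ unitary (Matrix (Fin q) (Fin q) F)) (d : Fin q → ℝ) :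
    (realLin (uᴴ * realDiag F d * u)).charpoly =
      ∏ k : Fin (q * Module.finrank ℝ F), (Polynomial.X - Polynomial.C (d k.divNat)) := by
  have hdiv (i : Fin q) (k : Fin (Module.finrank ℝ F)) : (finProdFinEquiv (i, k)).divNat = i :=
    congrArg Prod.fst (finProdFinEquiv.symm_apply_apply (i, k))
  refine Polynomial.funext fun c => ?_
  rw [eval_charpoly_realLin_conj hu, Polynomial.eval_prod, ← finProdFinEquiv.prod_comp,
    Fintype.prod_prod_type]
  simp [hdiv]

theorem sort_roots_charpoly_realLin_conj (hu : u ∈ unitary (Matrix (Fin q) (Fin q) F))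
    {d : Fin q → ℝ} (hd : Antitone d) :
    (realLin (uᴴ * realDiag F d * u)).charpoly.roots.sort (· ≥ ·) =
      List.ofFn fun k : Fin (q * Module.finrank ℝ F) => d k.divNat := by
  have hroots : (realLin (uᴴ * realDiag F d * u)).charpoly.roots =
      Finset.univ.val.map fun k : Fin (q * Module.finrank ℝ F) => d k.divNat := by
    rw [charpoly_realLin_conj hu, ← Polynomial.roots_multiset_prod_X_sub_C (Multiset.map _ _),
      Multiset.map_map]
    rfl
  have hsorted : (List.ofFn fun k : Fin (q * Module.finrank ℝ F) => d k.divNat).Pairwise (· ≥ ·) :=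
    List.pairwise_ofFn.2 fun _ _ hab => hd (Fin.le_def.2 (Nat.div_le_div_right hab.le))
  refine List.Perm.eq_of_pairwise' (Multiset.pairwise_sort _ _) hsorted
    (Multiset.coe_eq_coe.1 ?_)
  rw [Multiset.sort_eq, hroots, Fin.univ_val_map]

theorem eigenvalues_conj_realDiag (hu : u ∈ unitary (Matrix (Fin q) (Fin q) F)) {d : Fin q → ℝ}
    (hd : Antitone d) : eigenvalues (uᴴ * realDiag F d * u) = d := by
  ext j
  have hpos : 0 < Module.finrank ℝ F := Module.finrank_pos
  have hlt : Module.finrank ℝ F * j < q * Module.finrank ℝ F := by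
    rw [mul_comm]
    exact Nat.mul_lt_mul_of_pos_right j.2 hpos
  rw [eigenvalues, sort_roots_charpoly_realLin_conj hu hd,
    List.getD_eq_getElem _ _ (by simpa using hlt), List.getElem_ofFn]
  congr 1
  ext
  simp [Fin.divNat, hpos]

theorem logSing_eq (hu : u ∈ unitary (Matrix (Fin q) (Fin q) F)) {g : GL (Fin q) F}
    {t : EuclideanSpace ℝ (Fin q)} (ht : Antitone t)
    (h : (g : Matrix (Fin q) (Fin q) F)ᴴ * (g : Matrix (Fin q) (Fin q) F) =
      uᴴ * expDiag F t * u) : logSing g = t := by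
  have hd : Antitone fun i => Real.exp (2 * t i) := fun i j hij =>
    Real.exp_le_exp.2 (by linarith [ht hij])
  ext j
  have hsing : singularSpectrum g j = √(Real.exp (2 * t j)) := by
    rw [singularSpectrum, h]
    exact congrArg Real.sqrt (congrFun (eigenvalues_conj_realDiag hu hd) j)
  calc Real.log (singularSpectrum g j)
    _ = 2 * t j / 2 := by rw [hsing, Real.log_sqrt (Real.exp_pos _).le, Real.log_exp]
    _ = t j := mul_div_cancel_left₀ _ two_ne_zero

theorem exists_gram_eq [NormSqStar F] (g : GL (Fin q) F) :
    ∃ u : U F q, ∃ t : EuclideanSpace ℝ (Fin q), Antitone t ∧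
      (g : Matrix (Fin q) (Fin q) F)ᴴ * (g : Matrix (Fin q) (Fin q) F) =
        (u : Matrix (Fin q) (Fin q) F)ᴴ * expDiag F t * (u : Matrix (Fin q) (Fin q) F) := by
  set A := (g : Matrix (Fin q) (Fin q) F)ᴴ * (g : Matrix (Fin q) (Fin q) F) with hA
  have hpsd : Psd A := psd_conjTranspose_mul_self _
  have hdet : realDet A ≠ 0 := by
    rw [hA, realDet_mul]
    exact mul_ne_zero (realDet_conjTranspose_ne_zero (realDet_coe_ne_zero g))
      (realDet_coe_ne_zero g)
  obtain ⟨v, hv, d, hd, hanti⟩ := exists_unitary_conj_eq_diagonal hpsd.1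
    (wt := fun i : Fin q => -(i : ℝ)) fun i j h => Fin.ext (Nat.cast_injective (neg_injective h))
  have hpos : ∀ i, 0 < d i := pos_of_realDet_realDiag_ne_zero (F := F)
    (hpsd.nonneg_of_conj_eq_realDiag hd) (by rwa [← hd, realDet_unitary_conj hv])
  have hexp : expDiag F (WithLp.toLp 2 fun i => Real.log (d i) / 2) = realDiag F d := by
    refine congrArg (realDiag F) (funext fun i => ?_)
    rw [mul_div_cancel₀ _ two_ne_zero, Real.exp_log (hpos i)]
  refine ⟨star ⟨v, hv⟩, WithLp.toLp 2 fun i => Real.log (d i) / 2, fun i j hij => ?_, ?_⟩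
  · exact div_le_div_of_nonneg_right (Real.log_le_log (hpos j)
      (hanti i j (neg_le_neg (Nat.cast_le.2 hij)))) zero_le_two
  · have hvv : v * vᴴ = 1 := (Unitary.mem_iff.1 hv).2
    change A = vᴴᴴ * _ * vᴴ
    rw [hexp, ← hd, conjTranspose_conjTranspose, mul_assoc vᴴ, ← mul_assoc v, hvv, one_mul,
      mul_assoc, hvv, mul_one]

end Eigenvalues

section LogMinors

variable {F : Type*} [NormedDivisionRing F] [NormedAlgebra ℝ F] {q : ℕ}

/-- The leading principal block of `x` with (0-based) indices at most `r`, whose determinant is the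
leading minor `minor x r`. -/
abbrev leading (x : Matrix (Fin q) (Fin q) F) (r : Fin q) :
    Matrix {i // i ≤ r} {i // i ≤ r} F := x.toBlock (· ≤ r) (· ≤ r)

/-- Half the logarithm of the leading minor `minor x r`, written through the multiplicative
`realDet`. -/
def logMinor (x : Matrix (Fin q) (Fin q) F) (r : Fin q) : ℝ :=
  Real.log (realDet (leading x r)) / (2 * Module.finrank ℝ F)

theorem minor_eq_exp_logMinor {x : Matrix (Fin q) (Fin q) F} {r : Fin q}
    (h : 0 < realDet (leading x r)) : minor x r = Real.exp (2 * logMinor x r) := by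
  change realDet (leading x r) ^ (1 / (Module.finrank ℝ F : ℝ)) = _
  rw [Real.rpow_def_of_pos h, logMinor]
  congr 1
  ring

theorem logMinor_mono {x y : Matrix (Fin q) (Fin q) F} {r : Fin q} (h : 0 < realDet (leading x r))
    (hle : realDet (leading x r) ≤ realDet (leading y r)) : logMinor x r ≤ logMinor y r :=
  div_le_div_of_nonneg_right (Real.log_le_log h hle) (by positivity)

theorem conj_expDiag_const [StarRing F] {u : Matrix (Fin q) (Fin q) F}
    (hu : u ∈ unitary (Matrix (Fin q) (Fin q) F)) (c : ℝ) :
    uᴴ * expDiag F (WithLp.toLp 2 fun _ => c) * u = expDiag F (WithLp.toLp 2 fun _ => c) := by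
  have h : expDiag F (WithLp.toLp 2 fun _ : Fin q => c) = Real.exp (2 * c) • 1 :=
    realDiag_const (F := F) (n := Fin q) (Real.exp (2 * c))
  rw [h, Matrix.mul_smul, Matrix.smul_mul, Matrix.mul_one]
  exact congrArg _ (Unitary.mem_iff.1 hu).1

variable [FiniteDimensional ℝ F]

variable (F) in
theorem log_prod_exp_pow_div (t : Fin q → ℝ) (r : Fin q) :
    Real.log (∏ i : {i // i ≤ r}, Real.exp (2 * t i) ^ Module.finrank ℝ F) /
      (2 * Module.finrank ℝ F) = ∑ i ∈ Finset.Iic r, t i := by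
  have hd : (0 : ℝ) < 2 * Module.finrank ℝ F :=
    mul_pos two_pos (Nat.cast_pos.2 Module.finrank_pos)
  rw [div_eq_iff hd.ne', Real.log_prod fun i _ => (pow_pos (Real.exp_pos _) _).ne',
    Finset.sum_subtype (Finset.Iic r) fun _ => Finset.mem_Iic, Finset.sum_mul]
  refine Finset.sum_congr rfl fun i _ => ?_
  rw [Real.log_pow, Real.log_exp]
  ring

theorem realDet_leading_expDiag (t : EuclideanSpace ℝ (Fin q)) (r : Fin q) :
    realDet (leading (expDiag F t) r) =
      ∏ i : {i // i ≤ r}, Real.exp (2 * t i) ^ Module.finrank ℝ F := by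
  rw [leading, expDiag, toBlock_diagonal_self, ← realDet_realDiag]
  rfl

theorem logMinor_expDiag (t : EuclideanSpace ℝ (Fin q)) (r : Fin q) :
    logMinor (expDiag F t) r = ∑ i ∈ Finset.Iic r, t i := by
  rw [logMinor, realDet_leading_expDiag, log_prod_exp_pow_div]

variable [StarRing F] {u : Matrix (Fin q) (Fin q) F}

variable [NormSqStar F]

theorem realDet_leading_conj_mono (u : Matrix (Fin q) (Fin q) F) {s t : EuclideanSpace ℝ (Fin q)}
    (h : ∀ i, s i ≤ t i) (r : Fin q) :
    realDet (leading (uᴴ * expDiag F s * u) r) ≤ realDet (leading (uᴴ * expDiag F t * u) r) :=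
  realDet_conj_realDiag_mono (u.submatrix id Subtype.val) (fun _ => (Real.exp_pos _).le)
    fun i => Real.exp_le_exp.2 (mul_le_mul_of_nonneg_left (h i) zero_le_two)

theorem neg_norm_le_apply (t : EuclideanSpace ℝ (Fin q)) (i : Fin q) : -‖t‖ ≤ t i :=
  neg_le_of_abs_le (PiLp.norm_apply_le t i)

theorem realDet_leading_conj_pos (hu : u ∈ unitary (Matrix (Fin q) (Fin q) F))
    (t : EuclideanSpace ℝ (Fin q)) (r : Fin q) :
    0 < realDet (leading (uᴴ * expDiag F t * u) r) := by
  refine lt_of_lt_of_le ?_ (realDet_leading_conj_mono u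
    (s := WithLp.toLp 2 fun _ => -‖t‖) (neg_norm_le_apply t) r)
  rw [conj_expDiag_const hu, realDet_leading_expDiag]
  exact Finset.prod_pos fun _ _ => pow_pos (Real.exp_pos _) _

theorem logMinor_conj_le (hu : u ∈ unitary (Matrix (Fin q) (Fin q) F))
    {t : EuclideanSpace ℝ (Fin q)} (ht : Antitone t) (r : Fin q) :
    logMinor (uᴴ * expDiag F t * u) r ≤ ∑ i ∈ Finset.Iic r, t i := by
  rw [← logMinor_expDiag (F := F)]
  refine logMinor_mono (realDet_leading_conj_pos hu t r) ?_
  rw [realDet_leading_expDiag]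
  exact realDet_toBlock_conj_le_prod (· ≤ r) hu (c := Real.exp (2 * t r)) (Real.exp_pos _).le
    (fun i hi => Real.exp_le_exp.2 (mul_le_mul_of_nonneg_left (ht hi) zero_le_two))
    (fun i hi => Real.exp_le_exp.2 (mul_le_mul_of_nonneg_left (ht (not_le.1 hi).le) zero_le_two))
    fun i => (Real.exp_pos _).le

theorem le_logMinor_conj (t : EuclideanSpace ℝ (Fin q)) {r : Fin q}
    (h : realDet (leading u r) ≠ 0) :
    ∑ i ∈ Finset.Iic r, t i +
      Real.log (realDet ((leading u r)ᴴ * leading u r)) / (2 * Module.finrank ℝ F) ≤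
      logMinor (uᴴ * expDiag F t * u) r := by
  have h1 : 0 < realDet ((leading u r)ᴴ * leading u r) := by
    refine (psd_conjTranspose_mul_self (leading u r)).realDet_nonneg.lt_of_ne' ?_
    rw [realDet_mul]
    exact mul_ne_zero (realDet_conjTranspose_ne_zero h) h
  have h2 : 0 < ∏ i : {i // i ≤ r}, Real.exp (2 * t i) ^ Module.finrank ℝ F :=
    Finset.prod_pos fun _ _ => pow_pos (Real.exp_pos _) _
  rw [← log_prod_exp_pow_div F, ← add_div, ← Real.log_mul h2.ne' h1.ne', logMinor]
  exact div_le_div_of_nonneg_right (Real.log_le_log (mul_pos h2 h1)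
    (prod_mul_le_realDet_toBlock_conj (u := u) (· ≤ r) (d := fun i => Real.exp (2 * t i))
      fun i => (Real.exp_pos _).le)) (by positivity)

theorem abs_logMinor_conj_le (hu : u ∈ unitary (Matrix (Fin q) (Fin q) F))
    (t : EuclideanSpace ℝ (Fin q)) (r : Fin q) :
    |logMinor (uᴴ * expDiag F t * u) r| ≤ q * ‖t‖ := by
  have hconst (c : ℝ) : logMinor (uᴴ * expDiag F (WithLp.toLp 2 fun _ => c) * u) r =
      (Finset.Iic r).card * c := by
    rw [conj_expDiag_const hu, logMinor_expDiag, Finset.sum_const, nsmul_eq_mul]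
  have hcard : (Finset.Iic r).card * ‖t‖ ≤ q * ‖t‖ := by
    refine mul_le_mul_of_nonneg_right (Nat.cast_le.2 ?_) (norm_nonneg t)
    exact (Finset.card_le_univ _).trans_eq (Fintype.card_fin q)
  have hlo := logMinor_mono (realDet_leading_conj_pos hu _ r)
    (realDet_leading_conj_mono u (s := WithLp.toLp 2 fun _ => -‖t‖) (neg_norm_le_apply t) r)
  have hhi := logMinor_mono (realDet_leading_conj_pos hu t r)
    (realDet_leading_conj_mono u (t := WithLp.toLp 2 fun _ => ‖t‖)
      (fun i => (le_abs_self _).trans (PiLp.norm_apply_le t i)) r)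
  rw [hconst] at hlo hhi
  exact abs_le.2 ⟨by linarith, by linarith⟩

theorem realDet_leading_gram_pos (g : GL (Fin q) F) (r : Fin q) :
    0 < realDet (leading ((g : Matrix (Fin q) (Fin q) F)ᴴ * (g : Matrix (Fin q) (Fin q) F)) r) := by
  obtain ⟨u, t, -, h⟩ := exists_gram_eq g
  rw [h]
  exact realDet_leading_conj_pos u.2 t r

end LogMinors

section Cocycle

variable {F : Type*} [NormedDivisionRing F] {q : ℕ}

theorem leading_mul_of_blockTriangular (Y : Matrix (Fin q) (Fin q) F)
    {τ : Matrix (Fin q) (Fin q) F} (hτ : τ.BlockTriangular id) (r : Fin q) :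
    leading (Y * τ) r = leading Y r * leading τ r := by
  ext i j
  have h0 (k : {k // ¬ k ≤ r}) : Y i k * τ k j = 0 := by
    rw [hτ (j.2.trans_lt (not_le.1 k.2)), mul_zero]
  refine (Fintype.sum_subtype_add_sum_subtype (· ≤ r) fun k => Y i k * τ k j).symm.trans ?_
  rw [Finset.sum_eq_zero fun k _ => h0 k, add_zero]
  rfl

variable [StarRing F]

theorem leading_conj_of_blockTriangular (Y : Matrix (Fin q) (Fin q) F)
    {τ : Matrix (Fin q) (Fin q) F} (hτ : τ.BlockTriangular id) (r : Fin q) :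
    leading (τᴴ * Y * τ) r = (leading τ r)ᴴ * leading Y r * leading τ r := by
  have h : leading (τᴴ * Y) r = (leading (Yᴴ * τ) r)ᴴ := by
    rw [← conjTranspose_conjTranspose (τᴴ * Y), conjTranspose_mul, conjTranspose_conjTranspose]
    rfl
  rw [leading_mul_of_blockTriangular _ hτ, h, leading_mul_of_blockTriangular _ hτ,
    conjTranspose_mul]
  congr 2
  exact congrArg (leading · r) (conjTranspose_conjTranspose Y)

variable [NormedAlgebra ℝ F]

/-- The partial sums of the Iwasawa projection of `g`, which are the logarithms `logMinor` of the
leading minors of `g* g`. -/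
def logMinorGram (g : GL (Fin q) F) (r : Fin q) : ℝ :=
  logMinor ((g : Matrix (Fin q) (Fin q) F)ᴴ * (g : Matrix (Fin q) (Fin q) F)) r

variable [NormSqStar F] [FiniteDimensional ℝ F]

/-- Here `κ⁻¹ x` is the upper triangular factor of a QR decomposition of `x`. -/
theorem exists_logMinorGram_mul (x : GL (Fin q) F) : ∃ κ : U F q, ∀ (g : GL (Fin q) F) (r : Fin q),
    logMinorGram (g * x) r = logMinorGram (g * Unitary.toUnits κ) r + logMinorGram x r := by
  obtain ⟨v, hv, hτ⟩ := exists_unitary_mul_upperTriangular (x : Matrix (Fin q) (Fin q) F)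
  refine ⟨star ⟨v, hv⟩, fun g r => ?_⟩
  set κ : U F q := star ⟨v, hv⟩
  set τ := v * (x : Matrix (Fin q) (Fin q) F)
  set y : Matrix (Fin q) (Fin q) F := ↑(g * Unitary.toUnits κ : GL (Fin q) F)
  have hvv : vᴴ * v = 1 := (Unitary.mem_iff.1 hv).1
  have hgx : ((g * x : GL (Fin q) F) : Matrix (Fin q) (Fin q) F) = y * τ := by
    change (g : Matrix (Fin q) (Fin q) F) * x = g * vᴴ * (v * x)
    rw [mul_assoc, ← mul_assoc vᴴ, hvv, one_mul]
  have hx : (x : Matrix (Fin q) (Fin q) F)ᴴ * x = τᴴ * 1 * τ := by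
    rw [mul_one, conjTranspose_mul, mul_assoc, ← mul_assoc vᴴ, hvv, one_mul]
  have hgram : ((g * x : GL (Fin q) F) : Matrix (Fin q) (Fin q) F)ᴴ *
      ((g * x : GL (Fin q) F) : Matrix (Fin q) (Fin q) F) = τᴴ * (yᴴ * y) * τ := by
    rw [hgx, conjTranspose_mul, mul_assoc, mul_assoc, mul_assoc]
  have hdet : realDet (leading (τᴴ * (yᴴ * y) * τ) r) =
      realDet (leading (yᴴ * y) r) * realDet (leading (τᴴ * 1 * τ) r) := by
    rw [leading_conj_of_blockTriangular _ hτ, leading_conj_of_blockTriangular _ hτ, leading,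
      leading, leading, toBlock_one_self, mul_one, realDet_mul, realDet_mul, realDet_mul]
    ring
  have hy : 0 < realDet (leading (yᴴ * y) r) := realDet_leading_gram_pos _ r
  have hxpos := realDet_leading_gram_pos x r
  simp only [logMinorGram, logMinor, hgram, hdet, ← hx, Real.log_mul hy.ne' hxpos.ne', add_div]
  rfl

end Cocycle

/-! ### The Iwasawa projection -/

section Topology

variable {F : Type*} [NormedDivisionRing F] {q : ℕ}

theorem continuous_leading (r : Fin q) :
    Continuous fun x : Matrix (Fin q) (Fin q) F => leading x r :=
  continuous_id.matrix_submatrix _ _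

variable [NormedAlgebra ℝ F]

theorem continuous_expDiag : Continuous fun t : EuclideanSpace ℝ (Fin q) => expDiag F t :=
  Continuous.matrix_diagonal (continuous_pi fun i =>
    (continuous_algebraMap ℝ F).comp (Real.continuous_exp.comp (by fun_prop)))

theorem continuous_toUnits [StarRing F] [NormSqStar F] :
    Continuous fun u : U F q => (Unitary.toUnits u : GL (Fin q) F) :=
  Units.continuous_iff.2 ⟨continuous_subtype_val, continuous_star.comp continuous_subtype_val⟩

variable [FiniteDimensional ℝ F]

variable (F) in
theorem secondCountableTopology_matrix : SecondCountableTopology (Matrix (Fin q) (Fin q) F) := by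
  have : ProperSpace F := FiniteDimensional.proper_real F
  exact inferInstanceAs (SecondCountableTopology (Fin q → Fin q → F))

instance instSecondCountableTopologyGL : SecondCountableTopology (GL (Fin q) F) := by
  have := secondCountableTopology_matrix F (q := q)
  have : SecondCountableTopology (Matrix (Fin q) (Fin q) F)ᵐᵒᵖ :=
    MulOpposite.opHomeomorph.symm.isInducing.secondCountableTopology
  exact Units.isEmbedding_embedProduct.isInducing.secondCountableTopology

theorem continuous_realDet {n : Type*} [Fintype n] :
    Continuous (realDet : Matrix n n F → ℝ) := by
  let Φ : Matrix n n F →ₗ[ℝ] (n → F) →L[ℝ] (n → F) :=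
    { toFun := fun A => LinearMap.toContinuousLinearMap (realLin A)
      map_add' := fun A B => by rw [realLin_add, map_add]
      map_smul' := fun c A => by rw [realLin_smul, map_smul, RingHom.id_apply] }
  exact ContinuousLinearMap.continuous_det.comp Φ.continuous_of_finiteDimensional

theorem continuous_logMinor {α : Type*} [TopologicalSpace α] {f : α → Matrix (Fin q) (Fin q) F}
    (hf : Continuous f) {r : Fin q} (h : ∀ a, 0 < realDet (leading (f a) r)) :
    Continuous fun a => logMinor (f a) r :=
  ((continuous_realDet.comp ((continuous_leading r).comp hf)).log fun a => (h a).ne').div_const _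

variable [StarRing F] [NormSqStar F]

instance instSecondCountableTopologyU : SecondCountableTopology (U F q) := by
  have := secondCountableTopology_matrix F (q := q)
  exact TopologicalSpace.Subtype.secondCountableTopology _

instance instCompactSpaceU : CompactSpace (U F q) :=
  isCompact_iff_compactSpace.1 isCompact_unitary_matrix

instance instIsProbabilityMeasureHaarU : IsProbabilityMeasure (haarU F q) := by
  constructor
  rw [haarU, Measure.smul_apply, smul_eq_mul]
  exact ENNReal.inv_mul_cancel (Measure.measure_univ_ne_zero.2 NeZero.out) (measure_ne_top _ _)

instance instIsMulLeftInvariantHaarU : (haarU F q).IsMulLeftInvariant := by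
  rw [haarU]
  infer_instance

theorem continuous_logMinorGram (r : Fin q) :
    Continuous fun g : GL (Fin q) F => logMinorGram g r :=
  have h : Continuous fun g : GL (Fin q) F => (g : Matrix (Fin q) (Fin q) F) :=
    Units.continuous_val
  continuous_logMinor (h.matrix_conjTranspose.matrix_mul h) fun g => realDet_leading_gram_pos g r

theorem continuous_logMinor_conj (r : Fin q) :
    Continuous fun p : EuclideanSpace ℝ (Fin q) × U F q =>
      logMinor ((p.2 : Matrix (Fin q) (Fin q) F)ᴴ * expDiag F p.1 *
        (p.2 : Matrix (Fin q) (Fin q) F)) r :=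
  have h : Continuous fun p : EuclideanSpace ℝ (Fin q) × U F q =>
      (p.2 : Matrix (Fin q) (Fin q) F) := continuous_subtype_val.comp continuous_snd
  continuous_logMinor ((h.matrix_conjTranspose.matrix_mul
    (continuous_expDiag.comp continuous_fst)).matrix_mul h)
    fun p => realDet_leading_conj_pos p.2.2 p.1 r

end Topology

section Differences

variable {q : ℕ}

/-- The successive differences of a finite sequence, preceded by `0`. They recover the Iwasawa
projection from its partial sums. -/
def diffs : (Fin q → ℝ) →L[ℝ] EuclideanSpace ℝ (Fin q) :=
  LinearMap.toContinuousLinearMap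
    { toFun := fun f => WithLp.toLp 2 fun r =>
        f r - if h : 0 < (r : ℕ) then f ⟨(r : ℕ) - 1, by omega⟩ else 0
      map_add' := fun f g => by
        ext r
        simp only [Pi.add_apply, PiLp.add_apply]
        split_ifs <;> ring
      map_smul' := fun c f => by
        ext r
        simp only [Pi.smul_apply, PiLp.smul_apply, smul_eq_mul, RingHom.id_apply]
        split_ifs <;> ring }

theorem diffs_apply (f : Fin q → ℝ) (r : Fin q) :
    diffs f r = f r - if h : 0 < (r : ℕ) then f ⟨(r : ℕ) - 1, by omega⟩ else 0 := rfl

theorem diffs_sum_Iic (t : EuclideanSpace ℝ (Fin q)) :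
    diffs (fun r => ∑ i ∈ Finset.Iic r, t i) = t := by
  ext r
  rw [diffs_apply]
  split_ifs with h
  · have hIic : Finset.Iic r = insert r (Finset.Iic ⟨(r : ℕ) - 1, by omega⟩) := by
      ext i
      simp only [Finset.mem_Iic, Finset.mem_insert, Fin.le_def, Fin.ext_iff]
      omega
    rw [hIic, Finset.sum_insert (by simp [Fin.le_def]; omega), add_sub_cancel_right]
  · have hIic : Finset.Iic r = {r} := by
      ext i
      simp only [Finset.mem_Iic, Finset.mem_singleton, Fin.le_def, Fin.ext_iff]
      omega
    rw [hIic, Finset.sum_singleton, sub_zero]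

theorem sum_mul_sub_next (f lam : Fin q → ℝ) :
    ∑ r : Fin q, f r * (lam r - if h : (r : ℕ) + 1 < q then lam ⟨(r : ℕ) + 1, h⟩ else 0) =
      ∑ r, lam r * diffs f r := by
  cases q with
  | zero => simp
  | succ n =>
    have hnext : ∑ r : Fin (n + 1), f r *
        (if h : (r : ℕ) + 1 < n + 1 then lam ⟨(r : ℕ) + 1, h⟩ else 0) =
        ∑ r : Fin n, f r.castSucc * lam r.succ := by
      rw [Fin.sum_univ_castSucc]
      simp [Fin.succ]
    have hprev : ∑ r : Fin (n + 1), lam r *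
        (if h : 0 < (r : ℕ) then f ⟨(r : ℕ) - 1, by omega⟩ else 0) =
        ∑ r : Fin n, f r.castSucc * lam r.succ := by
      rw [Fin.sum_univ_succ]
      simp [Fin.castSucc, Fin.castAdd, Fin.castLE, mul_comm]
    simp only [diffs_apply, mul_sub, Finset.sum_sub_distrib, hnext, hprev, mul_comm (lam _) (f _)]

end Differences

section Iwasawa

variable {F : Type*} [NormedDivisionRing F] [NormedAlgebra ℝ F] [StarRing F] {q : ℕ}

/-- The Iwasawa projection `H(g)`: the logarithms of the diagonal entries of the triangular factor
in a QR decomposition of `g`, read off from the leading minors of `g* g`. -/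
def iwasawa (g : GL (Fin q) F) : EuclideanSpace ℝ (Fin q) := diffs (logMinorGram g)

variable [NormSqStar F] [FiniteDimensional ℝ F]

theorem continuous_iwasawa : Continuous (iwasawa : GL (Fin q) F → EuclideanSpace ℝ (Fin q)) :=
  diffs.continuous.comp (continuous_pi continuous_logMinorGram)

theorem exists_iwasawa_mul (x : GL (Fin q) F) : ∃ κ : U F q, ∀ g : GL (Fin q) F,
    iwasawa (g * x) = iwasawa (g * Unitary.toUnits κ) + iwasawa x := by
  obtain ⟨κ, hκ⟩ := exists_logMinorGram_mul x
  refine ⟨κ, fun g => ?_⟩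
  rw [iwasawa, iwasawa, iwasawa, ← map_add]
  exact congrArg diffs (funext (hκ g))

theorem exists_logMinorGram_mul_toUnits (g : GL (Fin q) F) : Antitone (logSing g) ∧
    ∃ k : U F q, ∀ (u : U F q) (r : Fin q),
      logMinorGram (g * Unitary.toUnits u) r =
        logMinor (((k * u : U F q) : Matrix (Fin q) (Fin q) F)ᴴ * expDiag F (logSing g) *
          ((k * u : U F q) : Matrix (Fin q) (Fin q) F)) r := by
  obtain ⟨k, t, ht, h⟩ := exists_gram_eq g
  have hlog := logSing_eq k.2 ht h
  refine ⟨hlog ▸ ht, k, fun u r => congrArg (logMinor · r) ?_⟩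
  change ((g : Matrix (Fin q) (Fin q) F) * (u : Matrix (Fin q) (Fin q) F))ᴴ *
      ((g : Matrix (Fin q) (Fin q) F) * (u : Matrix (Fin q) (Fin q) F)) =
    ((k : Matrix (Fin q) (Fin q) F) * (u : Matrix (Fin q) (Fin q) F))ᴴ * _ *
      ((k : Matrix (Fin q) (Fin q) F) * (u : Matrix (Fin q) (Fin q) F))
  rw [hlog, conjTranspose_mul, mul_assoc, ← mul_assoc (g : Matrix (Fin q) (Fin q) F)ᴴ, h,
    conjTranspose_mul]
  simp only [mul_assoc]

theorem logMinorGram_le_sum_logSing (g : GL (Fin q) F) (u : U F q) (r : Fin q) :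
    logMinorGram (g * Unitary.toUnits u) r ≤ ∑ i ∈ Finset.Iic r, logSing g i := by
  obtain ⟨ht, k, hk⟩ := exists_logMinorGram_mul_toUnits g
  rw [hk]
  exact logMinor_conj_le (k * u).2 ht r

theorem bddAbove_range_logMinorGram_mul_toUnits (g : GL (Fin q) F) (r : Fin q) :
    BddAbove (Set.range fun u : U F q => logMinorGram (g * Unitary.toUnits u) r) :=
  ⟨_, Set.forall_mem_range.2 fun u => logMinorGram_le_sum_logSing g u r⟩

theorem sum_logSing_eq_iSup (g : GL (Fin q) F) (r : Fin q) :
    ∑ i ∈ Finset.Iic r, logSing g i = ⨆ u : U F q, logMinorGram (g * Unitary.toUnits u) r := by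
  refine le_antisymm ?_ (ciSup_le fun u => logMinorGram_le_sum_logSing g u r)
  obtain ⟨-, k, hk⟩ := exists_logMinorGram_mul_toUnits g
  refine le_ciSup_of_le (bddAbove_range_logMinorGram_mul_toUnits g r) k⁻¹ ?_
  rw [hk, mul_inv_cancel, OneMemClass.coe_one, conjTranspose_one, one_mul, mul_one,
    logMinor_expDiag]

theorem measurable_logSing : Measurable (logSing : GL (Fin q) F → EuclideanSpace ℝ (Fin q)) := by
  have h : (logSing : GL (Fin q) F → EuclideanSpace ℝ (Fin q)) = fun g =>
      diffs fun r => ⨆ u : U F q, logMinorGram (g * Unitary.toUnits u) r := by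
    ext1 g
    simp only [← sum_logSing_eq_iSup, diffs_sum_Iic]
  rw [h]
  refine diffs.continuous.measurable.comp (measurable_pi_lambda _ fun r => ?_)
  refine (lowerSemicontinuous_ciSup
    (fun g => bddAbove_range_logMinorGram_mul_toUnits g r) fun u => ?_).measurable
  exact ((continuous_logMinorGram r).comp (continuous_mul_const _)).lowerSemicontinuous

end Iwasawa

/-! ### Moment functions -/

section Laplace

variable {Ω : Type*} [TopologicalSpace Ω] [CompactSpace Ω] [MeasurableSpace Ω] [BorelSpace Ω]
  {μ : Measure Ω} [IsFiniteMeasure μ]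

theorem hasDerivAt_integral_mul_exp {h a : Ω → ℝ} (hh : Continuous h) (ha : Continuous a) :
    HasDerivAt (fun s => ∫ u, h u * Real.exp (s * a u) ∂μ) (∫ u, h u * a u ∂μ) 0 := by
  have hcont : Continuous fun p : ℝ × Ω => h p.2 * a p.2 * Real.exp (p.1 * a p.2) := by fun_prop
  obtain ⟨C, hC⟩ := ((isCompact_closedBall (0 : ℝ) 1).prod
    isCompact_univ).exists_bound_of_continuousOn hcont.continuousOn
  have hmeas {f : Ω → ℝ} (hf : Continuous f) : AEStronglyMeasurable f μ :=
    hf.measurable.aestronglyMeasurable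
  have hint : Integrable (fun u => h u * Real.exp (0 * a u)) μ := by
    obtain ⟨B, hB⟩ := isCompact_univ.exists_bound_of_continuousOn hh.continuousOn
    refine Integrable.of_bound (hmeas (by fun_prop)) B (.of_forall fun u => ?_)
    simpa using hB u (Set.mem_univ u)
  have hderiv (u : Ω) (s : ℝ) : HasDerivAt (fun s => h u * Real.exp (s * a u))
      (h u * a u * Real.exp (s * a u)) s :=
    ((hasDerivAt_mul_const (a u)).exp.const_mul (h u)).congr_deriv (by ring)
  have key := hasDerivAt_integral_of_dominated_loc_of_deriv_le (bound := fun _ => C)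
    (Metric.closedBall_mem_nhds 0 one_pos) (.of_forall fun s => hmeas (by fun_prop)) hint
    (hmeas (by fun_prop)) (.of_forall fun u s hs => hC (s, u) ⟨hs, Set.mem_univ u⟩)
    (integrable_const C) (.of_forall fun u s _ => hderiv u s)
  simpa using key.2

variable {ι : Type*} [Fintype ι] [DecidableEq ι]

theorem hasLineDerivAt_integral_mul_exp {h : Ω → ℝ} {a : Ω → ι → ℝ} (hh : Continuous h)
    (ha : ∀ l, Continuous fun u => a u l) (lam : ι → ℝ) (j : ι) :
    HasLineDerivAt ℝ (fun lam : ι → ℝ =>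
      ((∫ u, h u * Real.exp (∑ l, lam l * a u l) ∂μ : ℝ) : ℂ))
      ((∫ u, h u * a u j * Real.exp (∑ l, lam l * a u l) ∂μ : ℝ) : ℂ) lam (Pi.single j 1) := by
  have hline (s : ℝ) (u : Ω) : h u * Real.exp (∑ l, (lam + s • Pi.single j 1 : ι → ℝ) l * a u l) =
      h u * Real.exp (∑ l, lam l * a u l) * Real.exp (s * a u j) := by
    simp [add_mul, Finset.sum_add_distrib, Pi.single_apply, Real.exp_add, mul_assoc]
  have key := hasDerivAt_integral_mul_exp (μ := μ)
    (h := fun u => h u * Real.exp (∑ l, lam l * a u l)) (a := fun u => a u j) (by fun_prop)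
    (by fun_prop)
  simp only [HasLineDerivAt, hline, mul_right_comm (h _) (a _ j)]
  exact key.ofReal_comp

end Laplace

section Moments

variable {F : Type*} [NormedDivisionRing F] [NormedAlgebra ℝ F] {q : ℕ}

theorem powerFun_half {x : Matrix (Fin q) (Fin q) F} (hx : ∀ r, 0 < realDet (leading x r))
    (lam : Fin q → ℝ) : powerFun (fun l => (lam l : ℂ) / 2) x =
      ((Real.exp (∑ l, lam l * diffs (logMinor x) l) : ℝ) : ℂ) := by
  rw [← sum_mul_sub_next, Real.exp_sum, Complex.ofReal_prod]
  refine Finset.prod_congr rfl fun r _ => ?_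
  rw [minor_eq_exp_logMinor (hx r),
    Complex.cpow_def_of_ne_zero (Complex.ofReal_ne_zero.2 (Real.exp_pos _).ne'),
    ← Complex.ofReal_log (Real.exp_pos _).le, Real.log_exp, Complex.ofReal_exp]
  congr 1
  split_ifs with h <;> push_cast <;> ring

variable [StarRing F]

variable (F) in
/-- The Iwasawa projection of `e^t u`, as a function of the chamber vector `t` and the unitary `u`.
Its Haar averages over `u` are the moment functions. -/
def iwasawaConj (t : EuclideanSpace ℝ (Fin q)) (u : U F q) : EuclideanSpace ℝ (Fin q) :=
  diffs (logMinor ((u : Matrix (Fin q) (Fin q) F)ᴴ * expDiag F t *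
    (u : Matrix (Fin q) (Fin q) F)))

variable [NormSqStar F] [FiniteDimensional ℝ F]

theorem continuous_iwasawaConj :
    Continuous fun p : EuclideanSpace ℝ (Fin q) × U F q => iwasawaConj F p.1 p.2 :=
  diffs.continuous.comp (continuous_pi continuous_logMinor_conj)

theorem continuous_iwasawaConj_apply (t : EuclideanSpace ℝ (Fin q)) (j : Fin q) :
    Continuous fun u : U F q => iwasawaConj F t u j :=
  (EuclideanSpace.proj (𝕜 := ℝ) j).continuous.comp (continuous_iwasawaConj.comp (.prodMk_right t))

theorem spherical_eq (t : EuclideanSpace ℝ (Fin q)) (lam : Fin q → ℝ) :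
    spherical F (fun l => -Complex.I * (rho F q l : ℂ) - Complex.I * (lam l : ℂ)) t =
      ((∫ u, Real.exp (∑ l, lam l * iwasawaConj F t u l) ∂(haarU F q) : ℝ) : ℂ) := by
  have hexp (l : Fin q) : (Complex.I * (-Complex.I * (rho F q l : ℂ) - Complex.I * (lam l : ℂ)) -
      (rho F q l : ℂ)) / 2 = (lam l : ℂ) / 2 := by
    linear_combination (-(rho F q l + lam l : ℂ) / 2) * Complex.I_mul_I
  rw [spherical, ← integral_complex_ofReal]
  simp only [hexp]
  exact integral_congr_ae (.of_forall fun u =>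
    powerFun_half (fun r => realDet_leading_conj_pos u.2 t r) lam)

theorem hasLineDerivAt_integral_iwasawaConj (t : EuclideanSpace ℝ (Fin q)) {h : U F q → ℝ}
    (hh : Continuous h) (lam : Fin q → ℝ) (j : Fin q) :
    HasLineDerivAt ℝ (fun lam : Fin q → ℝ => ((∫ u, h u *
        Real.exp (∑ l, lam l * iwasawaConj F t u l) ∂(haarU F q) : ℝ) : ℂ))
      ((∫ u, h u * iwasawaConj F t u j *
        Real.exp (∑ l, lam l * iwasawaConj F t u l) ∂(haarU F q) : ℝ) : ℂ)
      lam (Pi.single j 1) :=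
  hasLineDerivAt_integral_mul_exp hh (continuous_iwasawaConj_apply t) lam j

theorem lineDeriv_spherical (t : EuclideanSpace ℝ (Fin q)) (j : Fin q) :
    (fun lam : Fin q → ℝ => lineDeriv ℝ (fun lam : Fin q → ℝ =>
      spherical F (fun l => -Complex.I * (rho F q l : ℂ) - Complex.I * (lam l : ℂ)) t) lam
      (Pi.single j 1)) = fun lam => ((∫ u, iwasawaConj F t u j *
        Real.exp (∑ l, lam l * iwasawaConj F t u l) ∂(haarU F q) : ℝ) : ℂ) := by
  ext lam
  simp only [spherical_eq]
  simpa only [one_mul] using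
    (hasLineDerivAt_integral_iwasawaConj t (h := fun _ => 1) continuous_const lam j).lineDeriv

theorem m1_apply (t : EuclideanSpace ℝ (Fin q)) (j : Fin q) :
    m1 F t j = ∫ u, iwasawaConj F t u j ∂(haarU F q) := by
  have h := congrFun (lineDeriv_spherical (F := F) t j) 0
  simp only [m1, momentFun, List.foldr]
  rw [h]
  simp

theorem m2_apply (t : EuclideanSpace ℝ (Fin q)) (j l : Fin q) :
    m2 F t j l = ∫ u, iwasawaConj F t u j * iwasawaConj F t u l ∂(haarU F q) := by
  simp only [m2, momentFun, List.foldr, Matrix.of_apply]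
  rw [lineDeriv_spherical,
    (hasLineDerivAt_integral_iwasawaConj t (continuous_iwasawaConj_apply t l) 0 j).lineDeriv]
  simp [mul_comm]

theorem measurable_m1 (j : Fin q) :
    Measurable fun t : EuclideanSpace ℝ (Fin q) => m1 F t j := by
  simp only [m1_apply]
  refine (StronglyMeasurable.integral_prod_right (ν := haarU F q)
    (f := fun t u => iwasawaConj F t u j) (Measurable.stronglyMeasurable ?_)).measurable
  exact (by fun_prop : Measurable fun x : EuclideanSpace ℝ (Fin q) => x j).comp
    continuous_iwasawaConj.measurable

theorem measurable_m2 (j l : Fin q) :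
    Measurable fun t : EuclideanSpace ℝ (Fin q) => m2 F t j l := by
  simp only [m2_apply]
  refine (StronglyMeasurable.integral_prod_right (ν := haarU F q)
    (f := fun t u => iwasawaConj F t u j * iwasawaConj F t u l)
    (Measurable.stronglyMeasurable ?_)).measurable
  exact (by fun_prop : Measurable fun x : EuclideanSpace ℝ (Fin q) => x j * x l).comp
    continuous_iwasawaConj.measurable

theorem exists_iwasawa_mul_toUnits (g : GL (Fin q) F) : ∃ k : U F q, ∀ u : U F q,
    iwasawa (g * Unitary.toUnits u) = iwasawaConj F (logSing g) (k * u) := by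
  obtain ⟨-, k, hk⟩ := exists_logMinorGram_mul_toUnits g
  exact ⟨k, fun u => congrArg diffs (funext (hk u))⟩

theorem m1_logSing (g : GL (Fin q) F) (j : Fin q) :
    m1 F (logSing g) j = ∫ u, iwasawa (g * Unitary.toUnits u) j ∂(haarU F q) := by
  obtain ⟨k, hk⟩ := exists_iwasawa_mul_toUnits g
  simp only [hk, m1_apply]
  exact (integral_mul_left_eq_self (fun u => iwasawaConj F (logSing g) u j) k).symm

theorem m2_logSing (g : GL (Fin q) F) (j l : Fin q) :
    m2 F (logSing g) j l = ∫ u, iwasawa (g * Unitary.toUnits u) j *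
      iwasawa (g * Unitary.toUnits u) l ∂(haarU F q) := by
  obtain ⟨k, hk⟩ := exists_iwasawa_mul_toUnits g
  simp only [hk, m2_apply]
  exact (integral_mul_left_eq_self (fun u => iwasawaConj F (logSing g) u j *
    iwasawaConj F (logSing g) u l) k).symm

variable (F q) in
theorem exists_norm_iwasawa_le : ∃ C, ∀ g : GL (Fin q) F, ‖iwasawa g‖ ≤ C * ‖logSing g‖ := by
  refine ⟨‖diffs (q := q)‖ * q, fun g => ?_⟩
  obtain ⟨-, k, hk⟩ := exists_logMinorGram_mul_toUnits g
  have hbound : ‖logMinorGram g‖ ≤ q * ‖logSing g‖ := by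
    refine (pi_norm_le_iff_of_nonneg (by positivity)).2 fun r => ?_
    have h := hk 1 r
    rw [map_one, mul_one] at h
    rw [h]
    exact abs_logMinor_conj_le (k * 1).2 _ r
  rw [mul_assoc]
  exact (diffs.le_opNorm (logMinorGram g)).trans (by gcongr)

end Moments

/-! ### Leading minors of Haar distributed unitary matrices -/

section CountableLines

/-- Fubini in polar form: a dilate of `A` is null for almost every ratio. -/
theorem addHaar_eq_zero_of_countable_lines {E : Type*} [NormedAddCommGroup E] [NormedSpace ℝ E]
    [FiniteDimensional ℝ E] [MeasurableSpace E] [BorelSpace E] (μ : Measure E)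
    [μ.IsAddHaarMeasure] {A : Set E} (hA : MeasurableSet A) (z₀ : E)
    (h : ∀ z, {s : ℝ | z₀ + s • z ∈ A}.Countable) : μ A = 0 := by
  have hlines : ∀ᵐ z ∂μ, ∀ᵐ s : ℝ, z₀ + s • z ∉ A :=
    .of_forall fun z => measure_eq_zero_iff_ae_notMem.1 ((h z).measure_zero _)
  have hmeas : MeasurableSet {p : E × ℝ | z₀ + p.2 • p.1 ∉ A} :=
    (by fun_prop : Measurable fun p : E × ℝ => z₀ + p.2 • p.1) hA.compl
  obtain ⟨s, hs, hs0⟩ :=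
    (((Measure.ae_ae_comm hmeas).1 hlines).and (Measure.ae_ne volume 0)).exists
  have hdil : μ ((fun z => s • z) ⁻¹' ((fun z => z₀ + z) ⁻¹' A)) = 0 :=
    measure_eq_zero_iff_ae_notMem.2 hs
  rw [Measure.addHaar_preimage_smul μ hs0, measure_preimage_add] at hdil
  refine (mul_eq_zero.1 hdil).resolve_left ?_
  exact (ENNReal.ofReal_pos.2 (abs_pos.2 (inv_ne_zero (pow_ne_zero _ hs0)))).ne'

theorem exists_ae_notMem_of_countable_lines {Ω E : Type*} [MeasurableSpace Ω]
    (μ : Measure Ω) [SFinite μ] [NormedAddCommGroup E] [NormedSpace ℝ E]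
    [FiniteDimensional ℝ E] [MeasurableSpace E] [BorelSpace E] {A : Set (Ω × E)}
    (hA : MeasurableSet A)
    (h : ∀ ω, ∃ z₀, ∀ z, {s : ℝ | (ω, z₀ + s • z) ∈ A}.Countable) :
    ∃ z, ∀ᵐ ω ∂μ, (ω, z) ∉ A := by
  let ν : Measure E := Measure.addHaar
  have hfixed (ω : Ω) : ∀ᵐ z ∂ν, (ω, z) ∉ A := by
    obtain ⟨z₀, hz₀⟩ := h ω
    exact measure_eq_zero_iff_ae_notMem.1
      (addHaar_eq_zero_of_countable_lines ν (measurable_prodMk_left hA) z₀ hz₀)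
  exact ((Measure.ae_ae_comm hA.compl).1 (.of_forall hfixed)).exists

theorem finite_setOf_det_add_smul_eq_zero {K V : Type*} [Field K] [AddCommGroup V] [Module K V]
    [FiniteDimensional K V] {f : Module.End K V} (hf : LinearMap.det f ≠ 0) (g : Module.End K V) :
    {s : K | LinearMap.det (f + s • g) = 0}.Finite := by
  set e := LinearMap.equivOfDetNeZero f hf
  set h : Module.End K V := e.symm.toLinearMap ∘ₗ g
  refine ((Module.End.finite_hasEigenvalue h).image fun c => (-c)⁻¹).subset fun s hs => ?_
  obtain ⟨v, hv : f v + s • g v = 0, hv0⟩ :=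
    Submodule.exists_mem_ne_zero_of_ne_bot (LinearMap.bot_lt_ker_of_det_eq_zero hs).ne'
  have hsv : v + s • h v = 0 := by
    have := congrArg e.symm hv
    rwa [map_add, map_smul, map_zero, show f v = e v from rfl, e.symm_apply_apply] at this
  have hs0 : s ≠ 0 := by
    rintro rfl
    exact hv0 (by simpa using hsv)
  refine ⟨-s⁻¹, Module.End.hasEigenvalue_of_hasEigenvector
    (Module.End.hasEigenvector_iff.2 ⟨Module.End.mem_eigenspace_iff.2 ?_, hv0⟩), by simp⟩
  calc h v = s⁻¹ • s • h v := (inv_smul_smul₀ hs0 _).symm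
    _ = -s⁻¹ • v := by rw [eq_neg_of_add_eq_zero_right hsv, smul_neg, neg_smul]

end CountableLines

section HaarNull

variable {F : Type*} [NormedDivisionRing F] [NormedAlgebra ℝ F] [StarRing F] [NormSqStar F]
  [FiniteDimensional ℝ F] {q : ℕ}

theorem exists_ae_realDet_leading_mul_ne_zero (r : Fin q) : ∃ W : Matrix (Fin q) (Fin q) F,
    ∀ᵐ u : U F q ∂(haarU F q), realDet (leading ((u : Matrix (Fin q) (Fin q) F)ᴴ * W) r) ≠ 0 := by
  have : ProperSpace F := FiniteDimensional.proper_real F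
  let : MeasurableSpace F := borel F
  have : BorelSpace F := ⟨rfl⟩
  have hcont : Continuous fun p : U F q × (Fin q → Fin q → F) =>
      realDet (leading ((p.1 : Matrix (Fin q) (Fin q) F)ᴴ * of p.2) r) :=
    continuous_realDet.comp ((continuous_leading r).comp
      ((continuous_subtype_val.comp continuous_fst).matrix_conjTranspose.matrix_mul
        (B := fun p => of p.2) continuous_snd))
  have hmeas : MeasurableSet {p : U F q × (Fin q → Fin q → F) |
      realDet (leading ((p.1 : Matrix (Fin q) (Fin q) F)ᴴ * of p.2) r) = 0} :=
    (isClosed_singleton.preimage hcont).measurableSet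
  suffices hlines : ∀ (u : U F q) (Z : Fin q → Fin q → F), {s : ℝ | realDet (leading
      ((u : Matrix (Fin q) (Fin q) F)ᴴ * ((u : Matrix (Fin q) (Fin q) F) + s • of Z)) r) =
        0}.Countable by
    obtain ⟨W, hW⟩ := exists_ae_notMem_of_countable_lines (haarU F q) hmeas
      fun u => ⟨(u : Matrix (Fin q) (Fin q) F), hlines u⟩
    exact ⟨of W, hW⟩
  intro u Z
  have hone : realDet (leading ((u : Matrix (Fin q) (Fin q) F)ᴴ *
      (u : Matrix (Fin q) (Fin q) F)) r) ≠ 0 := by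
    rw [← star_eq_conjTranspose, (Unitary.mem_iff.1 u.2).1, leading, toBlock_one_self,
      realDet_one]
    exact one_ne_zero
  refine ((finite_setOf_det_add_smul_eq_zero hone (realLin
    (leading ((u : Matrix (Fin q) (Fin q) F)ᴴ * of Z) r))).subset fun s hs => ?_).countable
  rw [Set.mem_ofPred_eq, Matrix.mul_add, Matrix.mul_smul] at hs
  rw [Set.mem_ofPred_eq, ← realLin_smul, ← realLin_add]
  exact hs

theorem ae_realDet_leading_ne_zero (r : Fin q) :
    ∀ᵐ u : U F q ∂(haarU F q), realDet (leading (u : Matrix (Fin q) (Fin q) F) r) ≠ 0 := by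
  obtain ⟨W, hW⟩ := exists_ae_realDet_leading_mul_ne_zero (F := F) r
  obtain ⟨v, hv, hτ⟩ := exists_unitary_mul_upperTriangular W
  have hvW : W = vᴴ * (v * W) := by
    rw [← mul_assoc, ← star_eq_conjTranspose, (Unitary.mem_iff.1 hv).1, one_mul]
  have hmul : ∀ᵐ u : U F q ∂(haarU F q), realDet (leading
      (((⟨v, hv⟩ * u : U F q) : Matrix (Fin q) (Fin q) F)) r) ≠ 0 := by
    filter_upwards [hW] with u hu
    rw [hvW, ← mul_assoc, ← conjTranspose_mul, leading_mul_of_blockTriangular _ hτ,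
      realDet_mul] at hu
    exact congrArg (leading · r) (conjTranspose_conjTranspose (v * (u : Matrix _ _ F))) ▸
      realDet_conjTranspose_ne_zero (left_ne_zero_of_mul hu)
  simpa using (measurePreserving_mul_left (haarU F q) (⟨v, hv⟩ : U F q)⁻¹).quasiMeasurePreserving.ae
    hmul

end HaarNull

/-! ### Right-invariant random walks -/

section Invariance

variable {F : Type*} [NormedDivisionRing F] [NormedAlgebra ℝ F] [StarRing F] {q : ℕ}
  {μ ν : Measure (GL (Fin q) F)}

/-- Invariance of a measure on `GL(q, F)` under right multiplication with elements of `U(q, F)`,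
one half of `IsBiinvariant`. -/
def IsRightInvariant (μ : Measure (GL (Fin q) F)) : Prop :=
  ∀ u : U F q, μ.map (fun g => g * Unitary.toUnits u) = μ

variable [FiniteDimensional ℝ F]

theorem IsRightInvariant.mconv [SFinite μ] [SFinite ν] (hν : IsRightInvariant ν) :
    IsRightInvariant (μ ∗ₘ ν) := fun u => by
  rw [← Measure.mconv_dirac, Measure.mconv_assoc, Measure.mconv_dirac, hν u]

variable [NormSqStar F]

theorem IsRightInvariant.measurePreserving_mul [SFinite μ] (hμ : IsRightInvariant μ) :
    MeasurePreserving (fun p : GL (Fin q) F × U F q => p.1 * Unitary.toUnits p.2)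
      (μ.prod (haarU F q)) μ := by
  have hmeas : Measurable fun p : GL (Fin q) F × U F q => p.1 * Unitary.toUnits p.2 :=
    measurable_fst.mul (continuous_toUnits.measurable.comp measurable_snd)
  refine ⟨hmeas, Measure.ext fun s hs => ?_⟩
  have hslice (u : U F q) : μ ((fun g => g * Unitary.toUnits u) ⁻¹' s) = μ s := by
    rw [← Measure.map_apply (measurable_mul_const _) hs, hμ u]
  rw [Measure.map_apply hmeas hs, Measure.prod_apply_symm (hmeas hs)]
  simp only [← Set.preimage_comp, Function.comp_def, hslice, lintegral_const, measure_univ,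
    mul_one]

theorem IsRightInvariant.integrable_comp_mul [SFinite μ] (hμ : IsRightInvariant μ)
    {f : GL (Fin q) F → ℝ} (hf : Integrable f μ) :
    Integrable (fun p : GL (Fin q) F × U F q => f (p.1 * Unitary.toUnits p.2))
      (μ.prod (haarU F q)) :=
  hμ.measurePreserving_mul.integrable_comp_of_integrable hf

theorem IsRightInvariant.integral_integral_mul [SFinite μ] (hμ : IsRightInvariant μ)
    {f : GL (Fin q) F → ℝ} (hf : Integrable f μ) :
    ∫ g, ∫ u, f (g * Unitary.toUnits u) ∂(haarU F q) ∂μ = ∫ g, f g ∂μ := by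
  have hmp := hμ.measurePreserving_mul
  rw [integral_integral (f := fun g u => f (g * Unitary.toUnits u)) (hμ.integrable_comp_mul hf)]
  conv_rhs => rw [← hmp.map_eq]
  exact (integral_map hmp.aemeasurable (hmp.map_eq.symm ▸ hf.aestronglyMeasurable)).symm

theorem IsRightInvariant.measure_le [IsProbabilityMeasure μ] (hμ : IsRightInvariant μ)
    {S : Set (GL (Fin q) F)} (hS : MeasurableSet S) {c : ℝ≥0∞}
    (h : ∀ g, haarU F q {u | g * Unitary.toUnits u ∈ S} ≤ c) : μ S ≤ c := by
  have hmp := hμ.measurePreserving_mul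
  rw [← hmp.measure_preimage hS.nullMeasurableSet, Measure.prod_apply (hmp.measurable hS)]
  calc ∫⁻ g, haarU F q {u | g * Unitary.toUnits u ∈ S} ∂μ ≤ ∫⁻ _, c ∂μ := lintegral_mono h
    _ = c := by rw [lintegral_const, measure_univ, mul_one]

theorem IsRightInvariant.map_iwasawa_mconv [SFinite μ] [SFinite ν] (hμ : IsRightInvariant μ) :
    (μ ∗ₘ ν).map iwasawa = μ.map iwasawa ∗ ν.map iwasawa := by
  have hH : Measurable (iwasawa : GL (Fin q) F → EuclideanSpace ℝ (Fin q)) :=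
    continuous_iwasawa.measurable
  refine Measure.ext_of_lintegral _ fun f hf => ?_
  have hinner (x : GL (Fin q) F) :
      ∫⁻ g, f (iwasawa (g * x)) ∂μ = ∫⁻ g, f (iwasawa g + iwasawa x) ∂μ := by
    obtain ⟨κ, hκ⟩ := exists_iwasawa_mul x
    simp only [hκ]
    conv_rhs => rw [← hμ κ]
    exact (lintegral_map (hf.comp (hH.add_const _)) (measurable_mul_const _)).symm
  have hswap : ∫⁻ g, ∫⁻ x, f (iwasawa g + iwasawa x) ∂ν ∂μ =
      ∫⁻ x, ∫⁻ g, f (iwasawa g + iwasawa x) ∂μ ∂ν :=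
    lintegral_lintegral_swap (by fun_prop)
  have hconv : ∫⁻ y, f y ∂(μ.map iwasawa ∗ ν.map iwasawa) =
      ∫⁻ g, ∫⁻ x, f (iwasawa g + iwasawa x) ∂ν ∂μ := by
    rw [Measure.lintegral_conv hf, lintegral_map (by fun_prop) hH]
    exact lintegral_congr fun g => lintegral_map (by fun_prop) hH
  rw [lintegral_map hf hH, Measure.lintegral_mconv (f := fun g => f (iwasawa g)) (hf.comp hH),
    lintegral_lintegral_swap (by fun_prop), hconv, hswap]
  exact lintegral_congr hinner

end Invariance

section Defect

variable {F : Type*} [NormedDivisionRing F] [NormedAlgebra ℝ F] [StarRing F] {q : ℕ}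

/-- A bound for `ln σ_sing(g) - H(g)` at `g = e^t u`, which is uniform in `t`. The logarithms are
finite, and the bound valid, for `u` with nonvanishing leading minors, hence Haar-almost
everywhere. -/
def defectBound (u : U F q) : ℝ :=
  ‖diffs (q := q)‖ * ‖fun r => Real.log (realDet ((leading (u : Matrix (Fin q) (Fin q) F) r)ᴴ *
    leading (u : Matrix (Fin q) (Fin q) F) r)) / (2 * Module.finrank ℝ F)‖

variable [NormSqStar F] [FiniteDimensional ℝ F]

theorem measurable_defectBound : Measurable (defectBound : U F q → ℝ) := by
  refine (Measurable.norm (measurable_pi_lambda _ fun r => ?_)).const_mul _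
  have hlead : Continuous fun u : U F q => leading (u : Matrix (Fin q) (Fin q) F) r :=
    (continuous_leading r).comp continuous_subtype_val
  exact (Real.measurable_log.comp (continuous_realDet.comp
    (hlead.matrix_conjTranspose.matrix_mul hlead)).measurable).div_const _

theorem logSing_mul_toUnits (g : GL (Fin q) F) (u : U F q) :
    logSing (g * Unitary.toUnits u) = logSing g := by
  rw [← diffs_sum_Iic (logSing (g * _)), ← diffs_sum_Iic (logSing g)]
  refine congrArg diffs (funext fun r => ?_)
  rw [sum_logSing_eq_iSup, sum_logSing_eq_iSup]
  refine (Equiv.mulLeft u).iSup_congr fun v => ?_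
  rw [Equiv.coe_mulLeft, map_mul, mul_assoc]

theorem exists_norm_logSing_sub_iwasawa_le (g : GL (Fin q) F) : ∃ k : U F q, ∀ u : U F q,
    (∀ r, realDet (leading ((k * u : U F q) : Matrix (Fin q) (Fin q) F) r) ≠ 0) →
      ‖logSing (g * Unitary.toUnits u) - iwasawa (g * Unitary.toUnits u)‖ ≤
        defectBound (k * u) := by
  obtain ⟨-, k, hk⟩ := exists_logMinorGram_mul_toUnits g
  refine ⟨k, fun u hu => ?_⟩
  have hdiffs : logSing (g * Unitary.toUnits u) - iwasawa (g * Unitary.toUnits u) =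
      diffs ((fun r => ∑ i ∈ Finset.Iic r, logSing g i) -
        logMinorGram (g * Unitary.toUnits u)) := by
    rw [map_sub, diffs_sum_Iic, logSing_mul_toUnits, iwasawa]
  rw [hdiffs]
  refine (diffs.le_opNorm _).trans (mul_le_mul_of_nonneg_left ?_ (norm_nonneg _))
  refine (pi_norm_le_iff_of_nonneg (norm_nonneg _)).2 fun r => le_trans ?_ (norm_le_pi_norm _ r)
  have hnonneg := logMinorGram_le_sum_logSing g u r
  have hlower := le_logMinor_conj (logSing g) (hu r)
  rw [← hk] at hlower
  rw [Pi.sub_apply, Real.norm_eq_abs, Real.norm_eq_abs, abs_of_nonneg (sub_nonneg.2 hnonneg),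
    ← abs_neg]
  exact le_trans (by linarith) (le_abs_self _)

theorem exists_ae_norm_logSing_sub_iwasawa_le (g : GL (Fin q) F) : ∃ k : U F q,
    ∀ᵐ u : U F q ∂(haarU F q),
      ‖logSing (g * Unitary.toUnits u) - iwasawa (g * Unitary.toUnits u)‖ ≤
        defectBound (k * u) := by
  obtain ⟨k, hk⟩ := exists_norm_logSing_sub_iwasawa_le g
  have hminors : ∀ᵐ u : U F q ∂(haarU F q), ∀ r,
      realDet (leading (u : Matrix (Fin q) (Fin q) F) r) ≠ 0 :=
    ae_all_iff.2 ae_realDet_leading_ne_zero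
  refine ⟨k, ?_⟩
  filter_upwards [(eventually_mul_left_iff (haarU F q) k).2 hminors] with u hu using hk u hu

theorem IsRightInvariant.measure_logSing_sub_iwasawa_le {Ω : Type*} [MeasurableSpace Ω]
    {P : Measure Ω} [IsProbabilityMeasure P] {Y : Ω → GL (Fin q) F} (hY : Measurable Y)
    (hinv : IsRightInvariant (P.map Y)) (ε s : ℝ) :
    P {ω | ε ≤ ‖s • (logSing (Y ω) - iwasawa (Y ω))‖} ≤
      haarU F q {u | ε ≤ ‖s * defectBound u‖} := by
  have hprob : IsProbabilityMeasure (P.map Y) := Measure.isProbabilityMeasure_map hY.aemeasurable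
  have hmeas : MeasurableSet {g : GL (Fin q) F | ε ≤ ‖s • (logSing g - iwasawa g)‖} :=
    measurableSet_le measurable_const
      ((measurable_logSing.sub continuous_iwasawa.measurable).const_smul s).norm
  refine (Measure.map_apply hY hmeas).symm.trans_le (hinv.measure_le hmeas fun g => ?_)
  obtain ⟨k, hk⟩ := exists_ae_norm_logSing_sub_iwasawa_le g
  rw [← measure_preimage_mul (haarU F q) k {u | ε ≤ ‖s * defectBound u‖}]
  refine measure_mono_ae ?_
  filter_upwards [hk] with u hu (h : ε ≤ _)
  refine h.trans ?_
  rw [norm_smul, norm_mul]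
  exact mul_le_mul_of_nonneg_left (hu.trans (le_abs_self _)) (norm_nonneg s)

variable (F q) in
theorem tendstoInMeasure_defectBound :
    TendstoInMeasure (haarU F q) (fun (k : ℕ) u => (√(k : ℝ))⁻¹ * defectBound u) atTop 0 := by
  refine tendstoInMeasure_of_tendsto_ae
    (fun k => (measurable_defectBound.const_mul _).aestronglyMeasurable)
    (.of_forall fun u => ?_)
  have hsqrt : Tendsto (fun k : ℕ => (√(k : ℝ))⁻¹) atTop (𝓝 0) :=
    tendsto_inv_atTop_zero.comp (Real.tendsto_sqrt_atTop.comp tendsto_natCast_atTop_atTop)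
  simpa only [zero_mul, Pi.zero_apply] using hsqrt.mul_const (defectBound u)

end Defect

section Walk

variable {F : Type*} [NormedDivisionRing F] [NormedAlgebra ℝ F]
  [FiniteDimensional ℝ F] {q : ℕ} {Ω : Type*} {mΩ : MeasurableSpace Ω} {P : Measure Ω}
  {X : ℕ → Ω → GL (Fin q) F} {νG : Measure (GL (Fin q) F)}

theorem measurable_walk_of_lt {m : MeasurableSpace Ω} {k : ℕ} (hX : ∀ i < k, Measurable[m] (X i)) :
    Measurable[m] (walk X k) := by
  induction k with
  | zero => exact measurable_const
  | succ k ih => exact (ih fun i hi => hX i (by omega)).mul (hX k k.lt_succ_self)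

theorem measurable_walk (hX : ∀ k, Measurable (X k)) (k : ℕ) : Measurable (walk X k) :=
  measurable_walk_of_lt fun i _ => hX i

theorem indepFun_walk (hX : ∀ k, Measurable (X k)) (hind : iIndepFun X P) (k : ℕ) :
    IndepFun (walk X k) (X k) P := by
  have hpast : Measurable[⨆ i ∈ Set.Iio k, MeasurableSpace.comap (X i) inferInstance]
      (walk X k) :=
    measurable_walk_of_lt fun i hi => Measurable.of_comap_le (le_iSup₂_of_le i hi le_rfl)
  have hindep := indep_iSup_of_disjoint (fun i => (hX i).comap_le) hind
    (S := Set.Iio k) (T := {k}) (by simp)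
  rw [iSup_singleton] at hindep
  exact (IndepFun_iff_Indep _ _ _).2 (indep_of_indep_of_le_left hindep hpast.comap_le)

variable [IsProbabilityMeasure P]

theorem map_walk_succ (hX : ∀ k, Measurable (X k)) (hind : iIndepFun X P)
    (hlaw : ∀ k, P.map (X k) = νG) (k : ℕ) :
    P.map (walk X (k + 1)) = P.map (walk X k) ∗ₘ νG := by
  rw [← hlaw k]
  exact (indepFun_walk hX hind k).map_mul_eq_map_mconv_map₀ (measurable_walk hX k).aemeasurable
    (hX k).aemeasurable

variable [StarRing F]

theorem isRightInvariant_map_walk_succ (hX : ∀ k, Measurable (X k)) (hind : iIndepFun X P)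
    (hlaw : ∀ k, P.map (X k) = νG) (hinv : IsRightInvariant νG) (k : ℕ) :
    IsRightInvariant (P.map (walk X (k + 1))) := by
  have : SFinite νG := hlaw 0 ▸ inferInstance
  rw [map_walk_succ hX hind hlaw]
  exact hinv.mconv

variable [NormSqStar F]

theorem charFun_map_iwasawa_walk (hX : ∀ k, Measurable (X k)) (hind : iIndepFun X P)
    (hlaw : ∀ k, P.map (X k) = νG) (hinv : IsRightInvariant νG) (k : ℕ)
    (t : EuclideanSpace ℝ (Fin q)) :
    charFun ((P.map (walk X (k + 1))).map iwasawa) t = charFun (νG.map iwasawa) t ^ (k + 1) := by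
  have : IsFiniteMeasure νG := hlaw 0 ▸ inferInstance
  induction k with
  | zero =>
    have hwalk : walk X (0 + 1) = X 0 := funext fun ω => one_mul (X 0 ω)
    rw [hwalk, hlaw, zero_add, pow_one]
  | succ k ih =>
    rw [map_walk_succ hX hind hlaw,
      (isRightInvariant_map_walk_succ hX hind hlaw hinv k).map_iwasawa_mconv, charFun_conv, ih,
      pow_succ _ (k + 1)]

theorem tendstoInMeasure_logSing_sub_iwasawa (hX : ∀ k, Measurable (X k)) (hind : iIndepFun X P)
    (hlaw : ∀ k, P.map (X k) = νG) (hinv : IsRightInvariant νG) :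
    TendstoInMeasure P (fun (k : ℕ) ω => (√(k : ℝ))⁻¹ •
      (logSing (walk X k ω) - iwasawa (walk X k ω))) atTop 0 := by
  rw [tendstoInMeasure_iff_norm]
  intro ε hε
  have hbound := tendstoInMeasure_iff_norm.1 (tendstoInMeasure_defectBound F q) ε hε
  refine tendsto_of_tendsto_of_tendsto_of_le_of_le' tendsto_const_nhds hbound
    (.of_forall fun _ => zero_le) ?_
  filter_upwards [eventually_ge_atTop 1] with k hk
  obtain ⟨n, rfl⟩ := Nat.exists_eq_add_of_le' hk
  simp only [Pi.zero_apply, sub_zero]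
  exact (isRightInvariant_map_walk_succ hX hind hlaw hinv n).measure_logSing_sub_iwasawa_le
    (measurable_walk hX _) ε _

end Walk

/-! ### Central limit theorem -/

section CharFun

variable {Ω : Type*} {mΩ : MeasurableSpace Ω} {P : Measure Ω}

theorem charFun_map_sub_const {E : Type*} [NormedAddCommGroup E] [InnerProductSpace ℝ E]
    [MeasurableSpace E] [BorelSpace E] [SecondCountableTopology E] {Y : Ω → E}
    (hY : AEMeasurable Y P) (c t : E) :
    charFun (P.map fun ω => Y ω - c) t =
      charFun (P.map Y) t * Complex.exp (-(inner ℝ c t : ℝ) * Complex.I) := by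
  rw [← Complex.ofReal_neg, ← inner_neg_left, ← charFun_map_add_const,
    AEMeasurable.map_map_of_aemeasurable (by fun_prop) hY]
  simp only [Function.comp_def, sub_eq_add_neg]

theorem tendsto_charFun_inv_sqrt_pow [IsProbabilityMeasure P] {ξ : Ω → ℝ} (hξ : MemLp ξ 2 P) :
    Tendsto (fun n : ℕ => charFun (P.map fun ω => ξ ω - P[ξ]) (√(n : ℝ))⁻¹ ^ n) atTop
      (𝓝 (Complex.exp (-(Var[ξ; P] : ℂ) / 2))) := by
  have hmeas : AEMeasurable (fun ω => ξ ω - P[ξ]) P := hξ.aemeasurable.sub_const _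
  have hvar := variance_eq_integral hξ.aemeasurable
  obtain hzero | hpos := (variance_nonneg ξ P).eq_or_lt
  · have hconst : (fun ω => ξ ω - P[ξ]) =ᵐ[P] fun _ => 0 :=
      (ae_eq_integral_of_variance_eq_zero hξ hzero.symm).mono fun ω hω => sub_eq_zero.2 hω
    rw [← hzero, Measure.map_congr hconst, Measure.map_const]
    simp [charFun_dirac]
  · have hmean : ∫ ω, (ξ ω - P[ξ]) / √Var[ξ; P] ∂P = 0 := by
      rw [integral_div, integral_sub (hξ.integrable one_le_two) (integrable_const _)]
      simp
    have hsq : ∫ ω, ((ξ ω - P[ξ]) / √Var[ξ; P]) ^ 2 ∂P = 1 := by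
      simp only [div_pow]
      rw [integral_div, ← hvar, Real.sq_sqrt hpos.le, div_self hpos.ne']
    have hscale : (fun ω => ξ ω - P[ξ]) = fun ω => √Var[ξ; P] * ((ξ ω - P[ξ]) / √Var[ξ; P]) :=
      funext fun ω => (mul_div_cancel₀ _ (Real.sqrt_pos.2 hpos).ne').symm
    have key := tendsto_charFun_inv_sqrt_mul_pow (hmeas.div_const _) hmean hsq (√Var[ξ; P])
    rw [← Complex.ofReal_pow, Real.sq_sqrt hpos.le] at key
    refine key.congr fun n => ?_
    conv_rhs => rw [hscale, charFun_map_mul_comp (hmeas.div_const _), mul_comm]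

end CharFun

section CentralLimit

variable {E : Type*} [NormedAddCommGroup E] [InnerProductSpace ℝ E]
  [MeasurableSpace E] [BorelSpace E]

theorem charFun_map_inner_right (μ : Measure E) (t : E) (s : ℝ) :
    charFun (μ.map fun x => inner ℝ t x) s = charFun μ (s • t) := by
  have h := charFun_map_eq_charFunDual_smul (μ := μ) (innerSL ℝ t) s
  rw [← map_smul] at h
  exact h.trans (charFun_eq_charFunDual_toDualMap (s • t)).symm

variable [CompleteSpace E]

theorem tendsto_charFun_inv_sqrt_smul_pow {μ : Measure E} [IsProbabilityMeasure μ]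
    (hμ : MemLp id 2 μ) (t : E) :
    Tendsto (fun n : ℕ => (charFun μ ((√(n : ℝ))⁻¹ • t) *
        Complex.exp (-(inner ℝ (∫ x, x ∂μ) ((√(n : ℝ))⁻¹ • t) : ℝ) * Complex.I)) ^ n) atTop
      (𝓝 (Complex.exp (-(covarianceBilin μ t t : ℂ) / 2))) := by
  have hinner : MemLp (fun x => inner ℝ t x) 2 μ := hμ.const_inner t
  have hmean : ∫ x, inner ℝ t x ∂μ = inner ℝ t (∫ x, x ∂μ) :=
    integral_inner (hμ.integrable one_le_two) t
  have key := tendsto_charFun_inv_sqrt_pow hinner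
  rw [← covarianceBilin_self hμ, hmean] at key
  refine key.congr fun n => ?_
  rw [charFun_map_sub_const hinner.aemeasurable, charFun_map_inner_right]
  simp [inner_smul_right, real_inner_comm]

theorem tendstoInDistribution_of_charFun_eq_pow {ι : Type*} [Fintype ι] [DecidableEq ι]
    {Ω : Type*} {mΩ : MeasurableSpace Ω} {P : Measure Ω} [IsProbabilityMeasure P]
    {Y : ℕ → Ω → EuclideanSpace ℝ ι} (hY : ∀ k, AEMeasurable (Y k) P)
    {μ : Measure (EuclideanSpace ℝ ι)} [IsProbabilityMeasure μ] (hμ : MemLp id 2 μ)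
    (hpow : ∀ k t, charFun (P.map (Y (k + 1))) t = charFun μ t ^ (k + 1))
    {S : Matrix ι ι ℝ} (hS : S.PosSemidef) (hcov : ∀ t, covarianceBilin μ t t = t ⬝ᵥ S *ᵥ t) :
    TendstoInDistribution (fun (k : ℕ) ω => (√(k : ℝ))⁻¹ • (Y k ω - (k : ℝ) • ∫ x, x ∂μ))
      atTop id (fun _ => P) (multivariateGaussian 0 S) where
  forall_aemeasurable k := ((hY k).sub_const ((k : ℝ) • ∫ x, x ∂μ)).fun_const_smul _
  tendsto := by
    refine ProbabilityMeasure.tendsto_iff_tendsto_charFun.2 fun t => ?_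
    have hgauss : charFun ((multivariateGaussian 0 S).map id) t =
        Complex.exp (-(covarianceBilin μ t t : ℂ) / 2) := by
      rw [Measure.map_id, charFun_multivariateGaussian hS, hcov]
      simp [neg_div]
    simp only [ProbabilityMeasure.coe_mk, hgauss]
    refine (tendsto_charFun_inv_sqrt_smul_pow hμ t).congr' ?_
    filter_upwards [eventually_ge_atTop 1] with k hk
    obtain ⟨n, rfl⟩ := Nat.exists_eq_add_of_le' hk
    rw [charFun_map_smul_comp ((hY _).sub_const _), charFun_map_sub_const (hY _), hpow, mul_pow,
      ← Complex.exp_nat_mul, real_inner_smul_left]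
    congr 2
    push_cast
    ring

end CentralLimit

theorem memLp_two_of_integrable_sq {ι : Type*} [Fintype ι] {ν : Measure (EuclideanSpace ℝ ι)}
    (hν : ∀ j, Integrable (fun t : EuclideanSpace ℝ ι => t j ^ 2) ν) : MemLp id 2 ν :=
  MemLp.of_eval_piLp fun j => (memLp_two_iff_integrable_sq
    (by fun_prop : Measurable fun t : EuclideanSpace ℝ ι => t j).aestronglyMeasurable).2 (hν j)

section MomentsOfLaw

variable {F : Type*} [NormedDivisionRing F] [NormedAlgebra ℝ F] [StarRing F] [NormSqStar F]
  [FiniteDimensional ℝ F] {q : ℕ} {νG : Measure (GL (Fin q) F)}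

theorem memLp_iwasawa (hmom : MemLp logSing 2 νG) : MemLp iwasawa 2 νG := by
  obtain ⟨C, hC⟩ := exists_norm_iwasawa_le F q
  exact hmom.of_le_mul continuous_iwasawa.aestronglyMeasurable (.of_forall hC)

theorem integrable_m1 [SFinite νG] (hinv : IsRightInvariant νG) (h : Integrable iwasawa νG) :
    Integrable (m1 F) (νG.map logSing) := by
  refine Integrable.of_eval_piLp fun j => ?_
  rw [integrable_map_measure (measurable_m1 j).aestronglyMeasurable measurable_logSing.aemeasurable]
  simp only [Function.comp_def, m1_logSing]
  exact (hinv.integrable_comp_mul (h.eval_piLp j)).integral_prod_left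

theorem dispersion_map_logSing [SFinite νG] (hinv : IsRightInvariant νG)
    (h : Integrable iwasawa νG) : dispersion F (νG.map logSing) = ∫ g, iwasawa g ∂νG := by
  ext j
  rw [dispersion, eval_integral_piLp (integrable_m1 hinv h).eval_piLp,
    eval_integral_piLp h.eval_piLp,
    integral_map measurable_logSing.aemeasurable (measurable_m1 j).aestronglyMeasurable]
  simp only [m1_logSing, hinv.integral_integral_mul (h.eval_piLp j)]

variable [IsProbabilityMeasure νG]

theorem integrable_m2 (hinv : IsRightInvariant νG) (h : MemLp iwasawa 2 νG) (j l : Fin q) :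
    Integrable (fun t => m2 F t j l) (νG.map logSing) := by
  rw [integrable_map_measure (measurable_m2 j l).aestronglyMeasurable
    measurable_logSing.aemeasurable]
  simp only [Function.comp_def, m2_logSing]
  exact (hinv.integrable_comp_mul
    ((h.eval_piLp j).integrable_mul (h.eval_piLp l))).integral_prod_left

theorem modCov_map_logSing (hinv : IsRightInvariant νG) (h : MemLp iwasawa 2 νG) (j l : Fin q) :
    modCov F (νG.map logSing) j l = cov[fun g => iwasawa g j, fun g => iwasawa g l; νG] := by
  have hint := h.integrable one_le_two
  have hjl : Integrable (fun g => iwasawa g j * iwasawa g l) νG :=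
    (h.eval_piLp j).integrable_mul (h.eval_piLp l)
  have hm2 : ∫ t, m2 F t j l ∂(νG.map logSing) = ∫ g, iwasawa g j * iwasawa g l ∂νG := by
    rw [integral_map measurable_logSing.aemeasurable (measurable_m2 j l).aestronglyMeasurable,
      ← hinv.integral_integral_mul hjl]
    simp only [m2_logSing]
  rw [modCov, Matrix.of_apply, hm2, dispersion_map_logSing hinv hint,
    eval_integral_piLp hint.eval_piLp, eval_integral_piLp hint.eval_piLp,
    covariance_eq_sub (h.eval_piLp j) (h.eval_piLp l)]
  rfl

theorem covarianceBilin_map_iwasawa (hinv : IsRightInvariant νG) (h : MemLp iwasawa 2 νG)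
    (x y : EuclideanSpace ℝ (Fin q)) :
    covarianceBilin (νG.map iwasawa) x y = x ⬝ᵥ modCov F (νG.map logSing) *ᵥ y := by
  refine (covarianceBilin_apply_pi h.eval_piLp x y).trans ?_
  simp only [dotProduct, mulVec, Finset.mul_sum, modCov_map_logSing hinv h]
  exact Finset.sum_congr rfl fun j _ => Finset.sum_congr rfl fun l _ => by ring

theorem posSemidef_modCov (hinv : IsRightInvariant νG) (h : MemLp iwasawa 2 νG) :
    (modCov F (νG.map logSing)).PosSemidef := by
  refine .of_dotProduct_mulVec_nonneg (Matrix.IsHermitian.ext fun j l => ?_) fun x => ?_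
  · rw [star_trivial, modCov_map_logSing hinv h, modCov_map_logSing hinv h, covariance_comm]
  · rw [star_trivial]
    exact (covarianceBilin_self_nonneg (WithLp.toLp 2 x)).trans_eq
      (covarianceBilin_map_iwasawa hinv h _ _)

end MomentsOfLaw

section WalkLimit

variable {F : Type*} [NormedDivisionRing F] [NormedAlgebra ℝ F] [StarRing F] [NormSqStar F]
  [FiniteDimensional ℝ F] {q : ℕ} {νG : Measure (GL (Fin q) F)} {Ω : Type*}
  {mΩ : MeasurableSpace Ω} {P : Measure Ω} [IsProbabilityMeasure P] {X : ℕ → Ω → GL (Fin q) F}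

theorem tendstoInDistribution_iwasawa_walk [IsProbabilityMeasure νG] (hX : ∀ k, Measurable (X k))
    (hind : iIndepFun X P) (hlaw : ∀ k, P.map (X k) = νG) (hinv : IsRightInvariant νG)
    (h : MemLp iwasawa 2 νG) :
    TendstoInDistribution (fun (k : ℕ) ω => (√(k : ℝ))⁻¹ •
        (iwasawa (walk X k ω) - (k : ℝ) • dispersion F (νG.map logSing)))
      atTop id (fun _ => P) (multivariateGaussian 0 (modCov F (νG.map logSing))) := by
  have hH : Measurable (iwasawa : GL (Fin q) F → EuclideanSpace ℝ (Fin q)) :=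
    continuous_iwasawa.measurable
  have : IsProbabilityMeasure (νG.map iwasawa) := Measure.isProbabilityMeasure_map hH.aemeasurable
  have hmean : dispersion F (νG.map logSing) = ∫ x, x ∂(νG.map iwasawa) := by
    rw [dispersion_map_logSing hinv (h.integrable one_le_two)]
    exact (integral_map hH.aemeasurable aestronglyMeasurable_id).symm
  rw [hmean]
  refine tendstoInDistribution_of_charFun_eq_pow
    (fun k => (hH.comp (measurable_walk hX k)).aemeasurable)
    ((memLp_map_measure_iff aestronglyMeasurable_id hH.aemeasurable).2 h) (fun k t => ?_)
    (posSemidef_modCov hinv h) fun t => covarianceBilin_map_iwasawa hinv h t t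
  rw [← charFun_map_iwasawa_walk hX hind hlaw hinv, Measure.map_map hH (measurable_walk hX _)]

theorem tendstoInDistribution_logSing_walk [IsProbabilityMeasure νG] (hX : ∀ k, Measurable (X k))
    (hind : iIndepFun X P) (hlaw : ∀ k, P.map (X k) = νG) (hinv : IsRightInvariant νG)
    (h : MemLp iwasawa 2 νG) :
    TendstoInDistribution (fun (k : ℕ) ω => (√(k : ℝ))⁻¹ •
        (logSing (walk X k ω) - (k : ℝ) • dispersion F (νG.map logSing)))
      atTop id (fun _ => P) (multivariateGaussian 0 (modCov F (νG.map logSing))) := by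
  refine tendstoInDistribution_of_tendstoInMeasure_sub _ id
    (tendstoInDistribution_iwasawa_walk hX hind hlaw hinv h) ?_ fun k =>
    (((measurable_logSing.comp (measurable_walk hX k)).sub_const
      ((k : ℝ) • dispersion F (νG.map logSing))).fun_const_smul _).aemeasurable
  refine (tendstoInMeasure_logSing_sub_iwasawa hX hind hlaw hinv).congr_left fun k =>
    .of_forall fun ω => ?_
  simp only [Pi.sub_apply, ← smul_sub, sub_sub_sub_cancel_right]

end WalkLimit

end BiinvariantWalk

end

theorem theorem2p5_general {F : Type*} [NormedDivisionRing F] [NormedAlgebra ℝ F] [StarRing F]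
    [CStarRing F] [FiniteDimensional ℝ F] (hF : IsRealComplexOrQuaternion F) (q : ℕ)
    {Ω : Type*} [MeasurableSpace Ω] (P : Measure Ω) [IsProbabilityMeasure P]
    (νG : Measure (GL (Fin q) F)) (hinv : IsRightInvariant νG)
    (X : ℕ → Ω → GL (Fin q) F) (hX : ∀ k, Measurable (X k))
    (hlaw : ∀ k, P.map (X k) = νG) (hind : iIndepFun X P)
    (ν : Measure (EuclideanSpace ℝ (Fin q))) (hν : ν = νG.map logSing)
    (hmom : ∀ j, Integrable (fun t : EuclideanSpace ℝ (Fin q) => t j ^ 2) ν) :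
    Integrable (m1 F) ν ∧ (∀ j l, Integrable (fun t => m2 F t j l) ν) ∧
    (modCov F ν).PosSemidef ∧
    TendstoInDistribution
      (fun (k : ℕ) ω => (√(k : ℝ))⁻¹ • (logSing (walk X k ω) - (k : ℝ) • dispersion F ν))
      atTop id (fun _ => P) (multivariateGaussian 0 (modCov F ν)) := by
  have := hF.normSqStar
  have : IsProbabilityMeasure νG :=
    hlaw 0 ▸ Measure.isProbabilityMeasure_map (hX 0).aemeasurable
  subst hν
  have hiw : MemLp iwasawa 2 νG := memLp_iwasawa <|
    (memLp_two_of_integrable_sq hmom).comp_of_map measurable_logSing.aemeasurable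
  exact ⟨integrable_m1 hinv (hiw.integrable one_le_two), integrable_m2 hinv hiw,
    posSemidef_modCov hinv hiw, tendstoInDistribution_logSing_walk hX hind hlaw hinv hiw⟩

theorem theorem2p5 {F : Type*} [NormedDivisionRing F] [NormedAlgebra ℝ F] [StarRing F]
    [CStarRing F] [FiniteDimensional ℝ F] (hF : IsRealComplexOrQuaternion F)
    (q : ℕ) (hq : 2 ≤ q)
    {Ω : Type*} [MeasurableSpace Ω] (P : Measure Ω) [IsProbabilityMeasure P]
    (νG : Measure (GL (Fin q) F)) (hbi : IsBiinvariant νG)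
    (X : ℕ → Ω → GL (Fin q) F) (hX : ∀ k, Measurable (X k))
    (hlaw : ∀ k, P.map (X k) = νG) (hind : iIndepFun X P)
    (ν : Measure (EuclideanSpace ℝ (Fin q))) (hν : ν = νG.map logSing)
    (hmom : ∀ j, Integrable (fun t : EuclideanSpace ℝ (Fin q) => t j ^ 2) ν) :
    Integrable (m1 F) ν ∧ (∀ j l, Integrable (fun t => m2 F t j l) ν) ∧
    (modCov F ν).PosSemidef ∧
    TendstoInDistribution
      (fun (k : ℕ) ω => (√(k : ℝ))⁻¹ • (logSing (walk X k ω) - (k : ℝ) • dispersion F ν))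
      atTop id (fun _ => P) (multivariateGaussian 0 (modCov F ν)) :=
  theorem2p5_general hF q P νG (fun u => (hbi u).2) X hX hlaw hind ν hν hmom
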